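/- Let $N\in\mathbb C\setminus\{0\}$. Let $\mathsf{NCBipart}_N$ be the strict $\mathbb C$-linear monoidal category with object set $\mathbb N_0$ (tensor product of objects is addition) whose morphisms $k\to l$ are linear combinations of non-crossing diagrams with $k$ inputs and $l$ outputs built from strings and from black and white spiders $T^{\bullet}_{k,l},T^{\circ}_{k,l}$ (one vertex with $k$ inputs and $l$ outputs) by composition and tensor product, modulo the following relations and their upside-down versions: for each of the two colours, $$T_{0,0}=N\,\mathrm{id}_0,\qquad T_{1,1}=\mathrm{id}_1,$$ $$(T_{k_1+m,\,l_1}\otimes \mathrm{id}_{l_2})\circ(\mathrm{id}_{k_1}\otimes T_{k_2,\,m+l_2})=T_{k_1+k_2,\,l_1+l_2}\qquad(m\ge 1),$$ and, between the two colours, $$T^{\bullet}_{0,2}=T^{\circ}_{0,2},\qquad T^{\bullet}_{2,1}\circ T^{\circ}_{1,2}=\tfrac1N\,T^{\bullet}_{0,1}\circ T^{\circ}_{1,0}.$$ Turning diagrams upside down is denoted by $\dagger$. Let $\mathsf{NCBipartEven}_N\subset\mathsf{NCBipart}_N$ be the subcategory generated by $T^{\bullet}_{2,2}$, $T^{\circ}_{2,2}$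 and the cap $T^{\bullet}_{2,0}$; that is, its morphism spaces are spanned by all diagrams obtained from these three diagrams and strings by composition, tensor product and $\dagger$. Then $\mathsf{NCBipartEven}_N$ is pure: the endomorphism space of its unit object is $\mathbb C$, i.e. the map $\mathbb C\to\mathsf{NCBipartEven}_N(0,0)$, $z\mapsto z\,\mathrm{id}_0$, is bijective. In particular, every closed diagram (a diagram with no inputs and no outputs) built in the above way from the three generators equals $z\,\mathrm{id}_0$ for a unique $z\in\mathbb C$. -/

import Mathlib

open CategoryTheory MonoidalCategory

/-- The two colours of spiders. -/
inductive SpiderColor : Type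
  | black
  | white

/-- The complementary colour. -/
def SpiderColor.swap : SpiderColor → SpiderColor
  | .black => .white
  | .white => .black

/-- Non-crossing two-coloured spider diagrams with `k` input and `l` output strings, read from
bottom to top: everything that can be drawn from parallel strings and spiders by stacking and
juxtaposition. The cup and the cap are two-legged spiders. -/
inductive SpiderDiagram : ℕ → ℕ → Type
  /-- `k` parallel strings -/
  | strings (k : ℕ) : SpiderDiagram k k
  /-- one vertex of colour `c` with `k` input and `l` output strings -/
  | spider (c : SpiderColor) (k l : ℕ) : SpiderDiagram k l
  /-- `comp b a` : the diagram `b` on top of the diagram `a` -/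
  | comp {k l m : ℕ} (b : SpiderDiagram l m) (a : SpiderDiagram k l) : SpiderDiagram k m
  /-- `tensor a b` : the diagram `a` to the left of the diagram `b` -/
  | tensor {k l k' l' : ℕ} (a : SpiderDiagram k l) (b : SpiderDiagram k' l') :
      SpiderDiagram (k + k') (l + l')

namespace SpiderDiagram

/-- Parallel strings, seen as a diagram between two equal numbers. -/
def stringsEq {k l : ℕ} (h : k = l) : SpiderDiagram k l := h ▸ strings k

/-- The involution: the diagram turned upside down. -/
def dagger : {k l : ℕ} → SpiderDiagram k l → SpiderDiagram l k
  | _, _, strings k => strings k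
  | _, _, spider c k l => spider c l k
  | _, _, comp b a => comp (dagger a) (dagger b)
  | _, _, tensor a b => tensor (dagger a) (dagger b)

/-- `Rel N d z d'` says that `d = z • d'` is one of the relations imposed on diagrams: the axioms of
a strict monoidal category, the reduction rules for black spiders and for white spiders, the two
rules relating black and white spiders, and everything that arises from these by placing both sides
into a larger diagram. The list is invariant under turning diagrams upside down. -/
inductive Rel (N : ℂ) : {k l : ℕ} → SpiderDiagram k l → ℂ → SpiderDiagram k l → Prop
  -- placing both sides into a larger diagram
  | comp_left {k l m : ℕ} (b : SpiderDiagram l m) {a a' : SpiderDiagram k l} {z : ℂ} :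
      Rel N a z a' → Rel N (comp b a) z (comp b a')
  | comp_right {k l m : ℕ} {b b' : SpiderDiagram l m} (a : SpiderDiagram k l) {z : ℂ} :
      Rel N b z b' → Rel N (comp b a) z (comp b' a)
  | tensor_left {k l k' l' : ℕ} (a : SpiderDiagram k l) {b b' : SpiderDiagram k' l'} {z : ℂ} :
      Rel N b z b' → Rel N (tensor a b) z (tensor a b')
  | tensor_right {k l k' l' : ℕ} {a a' : SpiderDiagram k l} (b : SpiderDiagram k' l') {z : ℂ} :
      Rel N a z a' → Rel N (tensor a b) z (tensor a' b)
  -- axioms of a strict monoidal category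
  | strings_comp {k l : ℕ} (a : SpiderDiagram k l) : Rel N (comp (strings l) a) 1 a
  | comp_strings {k l : ℕ} (a : SpiderDiagram k l) : Rel N (comp a (strings k)) 1 a
  | comp_assoc {k l m n : ℕ} (c : SpiderDiagram m n) (b : SpiderDiagram l m)
      (a : SpiderDiagram k l) : Rel N (comp (comp c b) a) 1 (comp c (comp b a))
  | strings_tensor_strings (k l : ℕ) : Rel N (tensor (strings k) (strings l)) 1 (strings (k + l))
  | interchange {k l m k' l' m' : ℕ} (b : SpiderDiagram l m) (b' : SpiderDiagram l' m')
      (a : SpiderDiagram k l) (a' : SpiderDiagram k' l') :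
      Rel N (comp (tensor b b') (tensor a a')) 1 (tensor (comp b a) (comp b' a'))
  | strings_zero_tensor {k l : ℕ} (a : SpiderDiagram k l) :
      Rel N (comp (stringsEq (Nat.zero_add l)) (tensor (strings 0) a)) 1
        (comp a (stringsEq (Nat.zero_add k)))
  | tensor_strings_zero {k l : ℕ} (a : SpiderDiagram k l) :
      Rel N (comp (stringsEq (Nat.add_zero l)) (tensor a (strings 0))) 1
        (comp a (stringsEq (Nat.add_zero k)))
  | tensor_assoc {k l k' l' k'' l'' : ℕ} (a : SpiderDiagram k l) (b : SpiderDiagram k' l')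
      (c : SpiderDiagram k'' l'') :
      Rel N (comp (stringsEq (Nat.add_assoc l l' l'')) (tensor (tensor a b) c)) 1
        (comp (tensor a (tensor b c)) (stringsEq (Nat.add_assoc k k' k'')))
  -- rules for spiders of one colour: an isolated vertex is `N`, a two-legged vertex is a string,
  -- and two vertices joined by `m + 1` neighbouring strings merge into one vertex
  | spider_zero (c : SpiderColor) : Rel N (spider c 0 0) N (strings 0)
  | spider_one (c : SpiderColor) : Rel N (spider c 1 1) 1 (strings 1)
  | fuse (c : SpiderColor) (k₁ l₁ k₂ l₂ m : ℕ) :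
      Rel N
        (comp (tensor (spider c (k₁ + (m + 1)) l₁) (strings l₂))
          (comp (stringsEq (Nat.add_assoc k₁ (m + 1) l₂).symm)
            (tensor (strings k₁) (spider c k₂ ((m + 1) + l₂)))))
        1 (spider c (k₁ + k₂) (l₁ + l₂))
  | fuse_dagger (c : SpiderColor) (k₁ l₁ k₂ l₂ m : ℕ) :
      Rel N
        (comp (tensor (strings l₁) (spider c ((m + 1) + k₂) l₂))
          (comp (stringsEq (Nat.add_assoc l₁ (m + 1) k₂))
            (tensor (spider c k₁ (l₁ + (m + 1))) (strings k₂))))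
        1 (spider c (k₁ + k₂) (l₁ + l₂))
  -- rules relating the colours: black and white cups agree, black and white caps agree, and a
  -- double string between vertices of different colours can be cut at the price of `1 / N`
  | cup : Rel N (spider .black 0 2) 1 (spider .white 0 2)
  | cap : Rel N (spider .black 2 0) 1 (spider .white 2 0)
  | double (c : SpiderColor) :
      Rel N (comp (spider c 2 1) (spider c.swap 1 2)) N⁻¹
        (comp (spider c 0 1) (spider c.swap 1 0))

/-- The diagrams drawn from the black and the white spider with two inputs and two outputs and from
the cap, using strings, stacking, juxtaposition and turning upside down. -/
inductive IsEven : {k l : ℕ} → SpiderDiagram k l → Prop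
  | connecter (c : SpiderColor) : IsEven (spider c 2 2)
  | cap : IsEven (spider .black 2 0)
  | strings (k : ℕ) : IsEven (strings k)
  | comp {k l m : ℕ} {b : SpiderDiagram l m} {a : SpiderDiagram k l} :
      IsEven b → IsEven a → IsEven (comp b a)
  | tensor {k l k' l' : ℕ} {a : SpiderDiagram k l} {b : SpiderDiagram k' l'} :
      IsEven a → IsEven b → IsEven (tensor a b)
  | dagger {k l : ℕ} {a : SpiderDiagram k l} : IsEven a → IsEven (dagger a)

theorem IsEven.stringsEq {k l : ℕ} (h : k = l) : IsEven (SpiderDiagram.stringsEq h) := by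
  subst h; exact IsEven.strings k

end SpiderDiagram

noncomputable section

namespace NCBipart

/-- The span of the relations in the vector space of formal combinations of diagrams. -/
def relations (N : ℂ) (k l : ℕ) : Submodule ℂ (SpiderDiagram k l →₀ ℂ) :=
  Submodule.span ℂ {x | ∃ (d d' : SpiderDiagram k l) (z : ℂ), SpiderDiagram.Rel N d z d' ∧
    x = Finsupp.single d 1 - Finsupp.single d' z}

/-- The morphism space `NCBipart_N(k, l)`: combinations of diagrams modulo the relations. -/
abbrev Hom (N : ℂ) (k l : ℕ) : Type :=
  (SpiderDiagram k l →₀ ℂ) ⧸ relations N k l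

/-- The morphism given by a diagram. -/
def ofDiagram (N : ℂ) {k l : ℕ} (d : SpiderDiagram k l) : Hom N k l :=
  Submodule.Quotient.mk (Finsupp.single d 1)

variable {N : ℂ} {k l m n k' l' m' k'' l'' : ℕ}

theorem ofDiagram_eq {d d' : SpiderDiagram k l} {z : ℂ} (h : SpiderDiagram.Rel N d z d') :
    ofDiagram N d = z • ofDiagram N d' := by
  unfold ofDiagram
  rw [← Submodule.Quotient.mk_smul, Submodule.Quotient.eq, Finsupp.smul_single, smul_eq_mul, mul_one]
  exact Submodule.subset_span ⟨d, d', z, h, rfl⟩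

theorem ofDiagram_eq_one {d d' : SpiderDiagram k l} (h : SpiderDiagram.Rel N d 1 d') :
    ofDiagram N d = ofDiagram N d' := by
  rw [ofDiagram_eq h, one_smul]

theorem span_ofDiagram (x : Hom N k l) :
    x ∈ Submodule.span ℂ (Set.range (ofDiagram N : SpiderDiagram k l → Hom N k l)) := by
  induction x using Submodule.Quotient.induction_on with
  | H x =>
    induction x using Finsupp.induction_linear with
    | zero => exact Submodule.zero_mem _
    | add f g hf hg => exact Submodule.add_mem _ hf hg
    | single d z =>
      have : (Submodule.Quotient.mk (Finsupp.single d z) : Hom N k l) = z • ofDiagram N d := by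
        unfold ofDiagram
        rw [← Submodule.Quotient.mk_smul, Finsupp.smul_single, smul_eq_mul, mul_one]
      rw [this]
      exact Submodule.smul_mem _ _ (Submodule.subset_span ⟨d, rfl⟩)

theorem hom_ext {M : Type*} [AddCommGroup M] [Module ℂ M] {f g : Hom N k l →ₗ[ℂ] M}
    (h : ∀ d, f (ofDiagram N d) = g (ofDiagram N d)) : f = g := by
  refine LinearMap.ext fun x => ?_
  refine LinearMap.eqOn_span' (f := f) (g := g) ?_ (span_ofDiagram x)
  rintro _ ⟨d, rfl⟩
  exact h d

/-- A function on diagrams compatible with the relations extends linearly. -/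
def lift {M : Type*} [AddCommGroup M] [Module ℂ M] (f : SpiderDiagram k l → M)
    (hf : ∀ d d' z, SpiderDiagram.Rel N d z d' → f d = z • f d') : Hom N k l →ₗ[ℂ] M :=
  (relations N k l).liftQ (Finsupp.linearCombination ℂ f) (by
    rw [relations, Submodule.span_le]
    rintro _ ⟨d, d', z, h, rfl⟩
    simp [hf d d' z h])

@[simp]
theorem lift_ofDiagram {M : Type*} [AddCommGroup M] [Module ℂ M] (f : SpiderDiagram k l → M)
    (hf : ∀ d d' z, SpiderDiagram.Rel N d z d' → f d = z • f d') (d : SpiderDiagram k l) :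
    lift f hf (ofDiagram N d) = f d := by
  unfold lift ofDiagram
  rw [Submodule.liftQ_apply]
  simp

/-- Composition of morphisms, extending `SpiderDiagram.comp` bilinearly. -/
def comp : Hom N l m →ₗ[ℂ] Hom N k l →ₗ[ℂ] Hom N k m :=
  lift (fun b => lift (fun a => ofDiagram N (b.comp a))
    (fun _ _ _ h => ofDiagram_eq (h.comp_left b)))
    (fun _ _ _ h => hom_ext fun a => by simpa using ofDiagram_eq (h.comp_right a))

/-- Tensor product of morphisms, extending `SpiderDiagram.tensor` bilinearly. -/
def tensor : Hom N k l →ₗ[ℂ] Hom N k' l' →ₗ[ℂ] Hom N (k + k') (l + l') :=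
  lift (fun a => lift (fun b => ofDiagram N (a.tensor b))
    (fun _ _ _ h => ofDiagram_eq (h.tensor_left a)))
    (fun _ _ _ h => hom_ext fun b => by simpa using ofDiagram_eq (h.tensor_right b))

@[simp]
theorem comp_ofDiagram (b : SpiderDiagram l m) (a : SpiderDiagram k l) :
    comp (ofDiagram N b) (ofDiagram N a) = ofDiagram N (b.comp a) := by
  simp [comp]

@[simp]
theorem tensor_ofDiagram (a : SpiderDiagram k l) (b : SpiderDiagram k' l') :
    tensor (ofDiagram N a) (ofDiagram N b) = ofDiagram N (a.tensor b) := by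
  simp [tensor]

theorem comp_add (g : Hom N l m) (f f' : Hom N k l) : comp g (f + f') = comp g f + comp g f' :=
  map_add _ _ _

theorem comp_smul (g : Hom N l m) (r : ℂ) (f : Hom N k l) : comp g (r • f) = r • comp g f :=
  map_smul _ _ _

/-- To prove a statement about a morphism that is stable under linear combinations, it suffices to
check it on diagrams. -/
theorem hom_induction {P : Hom N k l → Prop} (x : Hom N k l) (h0 : P 0)
    (hadd : ∀ x y, P x → P y → P (x + y)) (hsmul : ∀ (z : ℂ) x, P x → P (z • x))
    (hd : ∀ d, P (ofDiagram N d)) : P x := by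
  refine Submodule.span_induction (p := fun x _ => P x) ?_ h0 (fun x y _ _ => hadd x y)
    (fun z x _ => hsmul z x) (span_ofDiagram x)
  rintro _ ⟨d, rfl⟩
  exact hd d

theorem strings_comp (x : Hom N k l) : comp (ofDiagram N (.strings l)) x = x := by
  induction x using hom_induction with
  | h0 => simp
  | hadd x y hx hy => rw [map_add, hx, hy]
  | hsmul z x hx => rw [map_smul, hx]
  | hd d => simpa using ofDiagram_eq_one (.strings_comp d)

theorem comp_strings (x : Hom N k l) : comp x (ofDiagram N (.strings k)) = x := by
  induction x using hom_induction with
  | h0 => simp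
  | hadd x y hx hy => rw [map_add, LinearMap.add_apply, hx, hy]
  | hsmul z x hx => rw [map_smul, LinearMap.smul_apply, hx]
  | hd d => simpa using ofDiagram_eq_one (.comp_strings d)

theorem comp_assoc (z : Hom N m n) (y : Hom N l m) (x : Hom N k l) :
    comp (comp z y) x = comp z (comp y x) := by
  induction z using hom_induction with
  | h0 => simp
  | hadd z w hz hw => simp only [map_add, LinearMap.add_apply, hz, hw]
  | hsmul r z hz => simp only [map_smul, LinearMap.smul_apply, hz]
  | hd c =>
  induction y using hom_induction with
  | h0 => simp
  | hadd z w hz hw => simp only [map_add, LinearMap.add_apply, hz, hw]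
  | hsmul r z hz => simp only [map_smul, LinearMap.smul_apply, hz]
  | hd b =>
  induction x using hom_induction with
  | h0 => simp
  | hadd z w hz hw => simp only [map_add, hz, hw]
  | hsmul r z hz => simp only [map_smul, hz]
  | hd a => simpa using ofDiagram_eq_one (.comp_assoc c b a)

theorem interchange (y : Hom N l m) (y' : Hom N l' m') (x : Hom N k l) (x' : Hom N k' l') :
    comp (tensor y y') (tensor x x') = tensor (comp y x) (comp y' x') := by
  induction y using hom_induction with
  | h0 => simp
  | hadd z w hz hw => simp only [map_add, LinearMap.add_apply, hz, hw]
  | hsmul r z hz => simp only [map_smul, LinearMap.smul_apply, hz]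
  | hd b =>
  induction y' using hom_induction with
  | h0 => simp
  | hadd z w hz hw => simp only [map_add, LinearMap.add_apply, hz, hw]
  | hsmul r z hz => simp only [map_smul, LinearMap.smul_apply, hz]
  | hd b' =>
  induction x using hom_induction with
  | h0 => simp
  | hadd z w hz hw => simp only [map_add, LinearMap.add_apply, hz, hw]
  | hsmul r z hz => simp only [map_smul, LinearMap.smul_apply, hz]
  | hd a =>
  induction x' using hom_induction with
  | h0 => simp
  | hadd z w hz hw => simp only [map_add, hz, hw]
  | hsmul r z hz => simp only [map_smul, hz]
  | hd a' => simpa using ofDiagram_eq_one (.interchange b b' a a')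

theorem tensor_assoc (x : Hom N k l) (y : Hom N k' l') (z : Hom N k'' l'') :
    comp (ofDiagram N (.stringsEq (Nat.add_assoc l l' l''))) (tensor (tensor x y) z) =
      comp (tensor x (tensor y z)) (ofDiagram N (.stringsEq (Nat.add_assoc k k' k''))) := by
  induction x using hom_induction with
  | h0 => simp
  | hadd z w hz hw => simp only [map_add, LinearMap.add_apply, hz, hw]
  | hsmul r z hz => simp only [map_smul, LinearMap.smul_apply, hz]
  | hd a =>
  induction y using hom_induction with
  | h0 => simp
  | hadd z w hz hw => simp only [map_add, LinearMap.add_apply, hz, hw]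
  | hsmul r z hz => simp only [map_smul, LinearMap.smul_apply, hz]
  | hd b =>
  induction z using hom_induction with
  | h0 => simp
  | hadd z w hz hw => simp only [map_add, LinearMap.add_apply, hz, hw]
  | hsmul r z hz => simp only [map_smul, LinearMap.smul_apply, hz]
  | hd c => simpa using ofDiagram_eq_one (.tensor_assoc a b c)

theorem strings_zero_tensor (x : Hom N k l) :
    comp (ofDiagram N (.stringsEq (Nat.zero_add l))) (tensor (ofDiagram N (.strings 0)) x) =
      comp x (ofDiagram N (.stringsEq (Nat.zero_add k))) := by
  induction x using hom_induction with
  | h0 => simp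
  | hadd z w hz hw => simp only [map_add, LinearMap.add_apply, hz, hw]
  | hsmul r z hz => simp only [map_smul, LinearMap.smul_apply, hz]
  | hd a => simpa using ofDiagram_eq_one (.strings_zero_tensor a)

theorem tensor_strings_zero (x : Hom N k l) :
    comp (ofDiagram N (.stringsEq (Nat.add_zero l))) (tensor x (ofDiagram N (.strings 0))) =
      comp x (ofDiagram N (.stringsEq (Nat.add_zero k))) := by
  induction x using hom_induction with
  | h0 => simp
  | hadd z w hz hw => simp only [map_add, LinearMap.add_apply, hz, hw]
  | hsmul r z hz => simp only [map_smul, LinearMap.smul_apply, hz]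
  | hd a =>
    rw [tensor_ofDiagram, comp_ofDiagram]
    exact (ofDiagram_eq_one (.tensor_strings_zero a)).trans (comp_ofDiagram _ _).symm

theorem stringsEq_comp (h : k = l) (h' : l = m) :
    comp (ofDiagram N (.stringsEq h')) (ofDiagram N (.stringsEq h)) =
      ofDiagram N (.stringsEq (h.trans h')) := by
  subst h h'
  exact strings_comp _

theorem stringsEq_comp₃ (h : k = l) (h' : l = m) (h'' : m = n) :
    comp (comp (ofDiagram N (.stringsEq h'')) (ofDiagram N (.stringsEq h')))
      (ofDiagram N (.stringsEq h)) = ofDiagram N (.stringsEq (h.trans (h'.trans h''))) := by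
  rw [stringsEq_comp, stringsEq_comp]

theorem stringsEq_tensor (h : k = l) (h' : k' = l') :
    tensor (ofDiagram N (.stringsEq h)) (ofDiagram N (.stringsEq h')) =
      ofDiagram N (.stringsEq (congrArg₂ (· + ·) h h')) := by
  subst h h'
  exact (tensor_ofDiagram _ _).trans (ofDiagram_eq_one (.strings_tensor_strings _ _))

/-- The morphism space `NCBipartEven_N(k, l)`, as the subspace of `NCBipart_N(k, l)` spanned by the
diagrams made from the generators. -/
def evenHom (N : ℂ) (k l : ℕ) : Submodule ℂ (Hom N k l) :=
  Submodule.span ℂ {x | ∃ d : SpiderDiagram k l, d.IsEven ∧ x = ofDiagram N d}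

theorem ofDiagram_mem {d : SpiderDiagram k l} (h : d.IsEven) : ofDiagram N d ∈ evenHom N k l :=
  Submodule.subset_span ⟨d, h, rfl⟩

theorem comp_mem {y : Hom N l m} {x : Hom N k l} (hy : y ∈ evenHom N l m)
    (hx : x ∈ evenHom N k l) : comp y x ∈ evenHom N k m := by
  have h := Submodule.apply_mem_map₂ comp hy hx
  rw [evenHom, evenHom, Submodule.map₂_span_span] at h
  refine Submodule.span_le.2 ?_ h
  rintro _ ⟨_, ⟨b, hb, rfl⟩, _, ⟨a, ha, rfl⟩, rfl⟩
  change comp (ofDiagram N b) (ofDiagram N a) ∈ evenHom N k m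
  rw [comp_ofDiagram]
  exact ofDiagram_mem (hb.comp ha)

theorem tensor_mem {x : Hom N k l} {y : Hom N k' l'} (hx : x ∈ evenHom N k l)
    (hy : y ∈ evenHom N k' l') : tensor x y ∈ evenHom N (k + k') (l + l') := by
  have h := Submodule.apply_mem_map₂ tensor hx hy
  rw [evenHom, evenHom, Submodule.map₂_span_span] at h
  refine Submodule.span_le.2 ?_ h
  rintro _ ⟨_, ⟨a, ha, rfl⟩, _, ⟨b, hb, rfl⟩, rfl⟩
  change tensor (ofDiagram N a) (ofDiagram N b) ∈ evenHom N (k + k') (l + l')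
  rw [tensor_ofDiagram]
  exact ofDiagram_mem (ha.tensor hb)

end NCBipart

/-- The objects of the category `NCBipart_N` are the natural numbers. -/
@[ext]
structure NCBipart (N : ℂ) : Type where
  strands : ℕ

namespace NCBipart

variable {N : ℂ}

instance : Category (NCBipart N) where
  Hom X Y := Hom N X.strands Y.strands
  id X := ofDiagram N (.strings X.strands)
  comp f g := comp g f
  id_comp f := comp_strings f
  comp_id f := strings_comp f
  assoc f g h := (comp_assoc h g f).symm

instance : Preadditive (NCBipart N) where
  homGroup X Y := inferInstanceAs (AddCommGroup (Hom N X.strands Y.strands))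
  add_comp _ _ _ f f' g := comp_add g f f'
  comp_add _ _ _ f g g' := LinearMap.map_add₂ comp g g' f

instance : Linear ℂ (NCBipart N) where
  homModule X Y := inferInstanceAs (Module ℂ (Hom N X.strands Y.strands))
  smul_comp _ _ _ r f g := comp_smul g r f
  comp_smul _ _ _ f r g := LinearMap.map_smul₂ comp r g f

/-- The identity between two equal objects. -/
def eqIso {X Y : NCBipart N} (h : X.strands = Y.strands) : X ≅ Y where
  hom := ofDiagram N (.stringsEq h)
  inv := ofDiagram N (.stringsEq h.symm)
  hom_inv_id := stringsEq_comp h h.symm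
  inv_hom_id := stringsEq_comp h.symm h

instance : MonoidalCategoryStruct (NCBipart N) where
  tensorObj X Y := ⟨X.strands + Y.strands⟩
  tensorUnit := ⟨0⟩
  tensorHom f g := tensor f g
  whiskerLeft X _ _ f := tensor (ofDiagram N (.strings X.strands)) f
  whiskerRight f Y := tensor f (ofDiagram N (.strings Y.strands))
  associator _ _ _ := eqIso (Nat.add_assoc _ _ _)
  leftUnitor _ := eqIso (Nat.zero_add _)
  rightUnitor _ := eqIso (Nat.add_zero _)

instance : MonoidalCategory (NCBipart N) :=
  MonoidalCategory.ofTensorHom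
    (id_tensorHom_id := fun _ _ => stringsEq_tensor rfl rfl)
    (id_tensorHom := fun _ _ _ _ => rfl)
    (tensorHom_id := fun _ _ => rfl)
    (tensorHom_comp_tensorHom := fun f₁ f₂ g₁ g₂ => interchange g₁ g₂ f₁ f₂)
    (associator_naturality := fun f₁ f₂ f₃ => tensor_assoc f₁ f₂ f₃)
    (leftUnitor_naturality := fun f => strings_zero_tensor f)
    (rightUnitor_naturality := fun f => tensor_strings_zero f)
    (pentagon := fun W X Y Z => by
      exact ((congrArg₂ (fun a b => comp (comp a _) b) (stringsEq_tensor rfl _)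
        (stringsEq_tensor _ rfl)).trans (stringsEq_comp₃ _ _ _)).trans (stringsEq_comp _ _).symm)
    (triangle := fun X Y =>
      ((congrArg (fun a => comp a _) (stringsEq_tensor rfl _)).trans (stringsEq_comp _ _)).trans
        (stringsEq_tensor _ rfl).symm)

end NCBipart

/-- The category `NCBipartEven_N`, with the natural numbers as objects: the monoidal subcategory of
`NCBipart_N` generated by the two four-legged spiders and the cap. -/
@[ext]
structure NCBipartEven (N : ℂ) : Type where
  strands : ℕ

namespace NCBipartEven

open NCBipart

variable {N : ℂ}

instance : Category (NCBipartEven N) where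
  Hom X Y := evenHom N X.strands Y.strands
  id X := ⟨ofDiagram N (.strings X.strands), ofDiagram_mem (.strings _)⟩
  comp f g := ⟨comp g.1 f.1, comp_mem g.2 f.2⟩
  id_comp f := Subtype.ext (comp_strings f.1)
  comp_id f := Subtype.ext (strings_comp f.1)
  assoc f g h := Subtype.ext (comp_assoc h.1 g.1 f.1).symm

instance : Preadditive (NCBipartEven N) where
  homGroup X Y := inferInstanceAs (AddCommGroup (evenHom N X.strands Y.strands))
  add_comp _ _ _ f f' g := Subtype.ext (map_add (comp g.1) f.1 f'.1)
  comp_add _ _ _ f g g' := Subtype.ext (LinearMap.map_add₂ comp g.1 g'.1 f.1)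

instance : Linear ℂ (NCBipartEven N) where
  homModule X Y := inferInstanceAs (Module ℂ (evenHom N X.strands Y.strands))
  smul_comp _ _ _ r f g := Subtype.ext (map_smul (comp g.1) r f.1)
  comp_smul _ _ _ f r g := Subtype.ext (LinearMap.map_smul₂ comp r g.1 f.1)

/-- The identity between two equal objects. -/
def eqIso {X Y : NCBipartEven N} (h : X.strands = Y.strands) : X ≅ Y where
  hom := ⟨ofDiagram N (.stringsEq h), ofDiagram_mem (.stringsEq h)⟩
  inv := ⟨ofDiagram N (.stringsEq h.symm), ofDiagram_mem (.stringsEq h.symm)⟩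
  hom_inv_id := Subtype.ext (stringsEq_comp h h.symm)
  inv_hom_id := Subtype.ext (stringsEq_comp h.symm h)

instance : MonoidalCategoryStruct (NCBipartEven N) where
  tensorObj X Y := ⟨X.strands + Y.strands⟩
  tensorUnit := ⟨0⟩
  tensorHom f g := ⟨tensor f.1 g.1, tensor_mem f.2 g.2⟩
  whiskerLeft X _ _ f :=
    ⟨tensor (ofDiagram N (.strings X.strands)) f.1, tensor_mem (ofDiagram_mem (.strings _)) f.2⟩
  whiskerRight f Y :=
    ⟨tensor f.1 (ofDiagram N (.strings Y.strands)), tensor_mem f.2 (ofDiagram_mem (.strings _))⟩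
  associator _ _ _ := eqIso (Nat.add_assoc _ _ _)
  leftUnitor _ := eqIso (Nat.zero_add _)
  rightUnitor _ := eqIso (Nat.add_zero _)

instance : MonoidalCategory (NCBipartEven N) :=
  MonoidalCategory.ofTensorHom
    (id_tensorHom_id := fun _ _ => Subtype.ext (stringsEq_tensor rfl rfl))
    (id_tensorHom := fun _ _ _ _ => rfl)
    (tensorHom_id := fun _ _ => rfl)
    (tensorHom_comp_tensorHom := fun f₁ f₂ g₁ g₂ =>
      Subtype.ext (interchange g₁.1 g₂.1 f₁.1 f₂.1))
    (associator_naturality := fun f₁ f₂ f₃ => Subtype.ext (tensor_assoc f₁.1 f₂.1 f₃.1))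
    (leftUnitor_naturality := fun f => Subtype.ext (strings_zero_tensor f.1))
    (rightUnitor_naturality := fun f => Subtype.ext (tensor_strings_zero f.1))
    (pentagon := fun W X Y Z => by
      apply Subtype.ext
      exact ((congrArg₂ (fun a b => comp (comp a _) b) (stringsEq_tensor rfl _)
        (stringsEq_tensor _ rfl)).trans (stringsEq_comp₃ _ _ _)).trans (stringsEq_comp _ _).symm)
    (triangle := fun X Y => Subtype.ext
      (((congrArg (fun a => comp a _) (stringsEq_tensor rfl _)).trans (stringsEq_comp _ _)).trans
        (stringsEq_tensor _ rfl).symm))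

end NCBipartEven

end

/-- A `ℂ`-linear monoidal category is pure if the endomorphism space of its unit object is `ℂ`: the
scalar multiples of the identity are pairwise distinct and exhaust the endomorphisms. -/
def IsPureCategory (C : Type*) [Category C] [Preadditive C] [Linear ℂ C] [MonoidalCategory C] :
    Prop :=
  Function.Bijective fun z : ℂ => z • 𝟙 (𝟙_ C)

/-!
The scalar `z` is unique because `id₀ ≠ 0`, and it exists because even diagrams are controlled by two
commuting copies of the Temperley–Lieb algebra.

*Uniqueness.* Every defining relation has the form `d = N ^ e • d'` with an integer `e` that does not
depend on `N`. For `N = 4` the category acts on tensor powers of `ℚ⁴`: black and white vertices are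
attached to two orthonormal bases, related by the Hadamard matrix with entries `±1/2`. A relation
`d = N ^ e • d'` multiplies the value of a diagram in this model by `4 ^ e` (`Model.eval_rel`). Hence,
for every `N ≠ 0`, sending a closed diagram to `N ^ e` if its value in the model is `4 ^ e`, and to `0`
if its value is not a power of `4`, respects all relations, and it sends `id₀` to `1`
(`unitFunctional`).

*Existence.* Let `P j` and `Q j` be the black and the white `(2, 2)`-vertex with `j` strings to its
right. They are idempotents, `P i` commutes with `P j`, `Q i` with `Q j`, and `N • P j Q j = cup ∘ cap`.
Moreover `P (j + 1) Q j P (j + 1) = N⁻¹ • P (j + 1)`, and the same with the colours exchanged: the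
bigon between the two colours can be cut (`cut_bigon`). Therefore `P 0, Q 1, P 2, …` and
`Q 0, P 1, Q 2, …` both satisfy the Temperley–Lieb relations, and the first family commutes with the
second. Padding inputs and outputs with cups and caps turns every even diagram into a scalar multiple
of a word in the `P j` and `Q j` (`IsLayered.exists_isWord`); a closed diagram `d` becomes
`cups ∘ d ∘ caps`. Such a word is a product `x y` with `x` from the first and `y` from the second
algebra. The element `F = cups ∘ caps` absorbs all `P (2 i)` and `Q (2 i)`. Compressing the last two
strands again and again, as with the conditional expectations of the Temperley–Lieb tower, gives
`F x y F = w • F F` (`TemperleyLieb.exists_smul_of_absorbs_pair`). As `caps ∘ cups` is a power of `N`,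
this determines `d` as a multiple of `id₀`.
-/

/-! ### The model for `N = 4` and the nonvanishing of the identity of the unit -/

namespace NCBipart.Model

/-- `basisVec c g` is the `g`-th vector of the orthonormal basis of `ℚ⁴` attached to the colour `c`:
the standard basis for black, and the rows of the symmetric orthogonal matrix `J / 2 - 1` with all
entries `±1/2` for white. -/
def basisVec : SpiderColor → Fin 4 → Fin 4 → ℚ
  | .black, g, x => if g = x then 1 else 0
  | .white, g, x => if g = x then -1 / 2 else 1 / 2

theorem basisVec_orthonormal (c : SpiderColor) (g h : Fin 4) :
    ∑ x, basisVec c g x * basisVec c h x = if g = h then 1 else 0 := by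
  cases c <;> fin_cases g <;> fin_cases h <;> simp [basisVec, Fin.sum_univ_four] <;> norm_num

theorem basisVec_symm (c : SpiderColor) (g h : Fin 4) : basisVec c g h = basisVec c h g := by
  cases c <;> simp [basisVec, eq_comm]

theorem basisVec_complete (c : SpiderColor) (x y : Fin 4) :
    ∑ g, basisVec c g x * basisVec c g y = if x = y then 1 else 0 := by
  simp only [basisVec_symm c _ x, basisVec_symm c _ y, basisVec_orthonormal]

/-- The two bases are unbiased: all inner products between them square to `1 / 4`. -/
theorem basisVec_flat (c : SpiderColor) (g h : Fin 4) :
    (∑ x, basisVec c g x * basisVec c.swap h x) * (∑ x, basisVec c g x * basisVec c.swap h x)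
      = 1 / 4 := by
  cases c <;> fin_cases g <;> fin_cases h <;>
    simp [basisVec, SpiderColor.swap, Fin.sum_univ_four] <;> norm_num

/-- The matrix entries of the operator `(ℚ⁴)^{⊗ k} → (ℚ⁴)^{⊗ l}` given by a diagram. A vertex of
colour `c` is `∑ g, v_g ⊗ ⋯ ⊗ v_g` over the orthonormal basis `v` of that colour. -/
def eval : {k l : ℕ} → SpiderDiagram k l → (Fin k → Fin 4) → (Fin l → Fin 4) → ℚ
  | _, _, .strings _, x, y => if x = y then 1 else 0
  | _, _, .spider c _ _, x, y => ∑ g, (∏ i, basisVec c g (x i)) * ∏ j, basisVec c g (y j)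
  | _, _, .comp b a, x, z => ∑ y, eval a x y * eval b y z
  | _, _, @SpiderDiagram.tensor k l k' l' a b, x, y =>
      eval a (fun i => x (Fin.castAdd k' i)) (fun j => y (Fin.castAdd l' j)) *
        eval b (fun i => x (Fin.natAdd k i)) (fun j => y (Fin.natAdd l j))

variable {k l m n k' l' m' k'' l'' : ℕ}

theorem eval_strings (x y : Fin k → Fin 4) :
    eval (.strings k) x y = if x = y then 1 else 0 := by simp [eval]

theorem eval_spider (c : SpiderColor) (x : Fin k → Fin 4) (y : Fin l → Fin 4) :
    eval (.spider c k l) x y =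
      ∑ g, (∏ i, basisVec c g (x i)) * ∏ j, basisVec c g (y j) := by simp [eval]

theorem eval_comp (b : SpiderDiagram l m) (a : SpiderDiagram k l) (x : Fin k → Fin 4)
    (z : Fin m → Fin 4) : eval (b.comp a) x z = ∑ y, eval a x y * eval b y z := by simp [eval]

theorem eval_tensor (a : SpiderDiagram k l) (b : SpiderDiagram k' l') (x : Fin (k + k') → Fin 4)
    (y : Fin (l + l') → Fin 4) : eval (a.tensor b) x y =
      eval a (fun i => x (Fin.castAdd k' i)) (fun j => y (Fin.castAdd l' j)) *
        eval b (fun i => x (Fin.natAdd k i)) (fun j => y (Fin.natAdd l j)) := by simp [eval]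

theorem eval_stringsEq_comp (h : l = m) (a : SpiderDiagram k l) (x : Fin k → Fin 4)
    (z : Fin m → Fin 4) :
    eval ((SpiderDiagram.stringsEq h).comp a) x z = eval a x (fun i => z (Fin.cast h i)) := by
  subst h
  simp [eval_comp, SpiderDiagram.stringsEq, eval_strings]

theorem eval_comp_stringsEq (h : k = l) (b : SpiderDiagram l m) (x : Fin k → Fin 4)
    (z : Fin m → Fin 4) :
    eval (b.comp (SpiderDiagram.stringsEq h)) x z = eval b (fun i => x (Fin.cast h.symm i)) z := by
  subst h
  simp [eval_comp, SpiderDiagram.stringsEq, eval_strings]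

theorem sum_append (f : (Fin (k + l) → Fin 4) → ℚ) :
    ∑ y, f y = ∑ u : Fin k → Fin 4, ∑ v : Fin l → Fin 4, f (Fin.append u v) := by
  rw [← Fintype.sum_prod_type' (fun u v => f (Fin.append u v))]
  exact (Fintype.sum_equiv (Fin.appendEquiv k l) _ _ fun _ => rfl).symm

theorem append_eq_iff (x : Fin (k + l) → Fin 4) (u : Fin k → Fin 4) (v : Fin l → Fin 4) :
    x = Fin.append u v ↔
      (fun i => x (Fin.castAdd l i)) = u ∧ (fun i => x (Fin.natAdd k i)) = v := by
  constructor
  · rintro rfl; simp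
  · rintro ⟨rfl, rfl⟩
    exact (Fin.append_castAdd_natAdd).symm

theorem sum_prod_basisVec (c : SpiderColor) (g h : Fin 4) (hn : n ≠ 0) :
    ∑ y : Fin n → Fin 4, (∏ i, basisVec c g (y i)) * ∏ i, basisVec c h (y i) =
      if g = h then 1 else 0 := by
  simp only [← Finset.prod_mul_distrib]
  rw [← Fintype.piFinset_univ, ← Finset.prod_univ_sum (fun _ => Finset.univ)
    (fun _ x => basisVec c g x * basisVec c h x)]
  simp only [basisVec_orthonormal]
  split_ifs <;> simp [hn]

/-- Contracting at least one common leg of two vertices of the same colour identifies their basis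
indices, by orthonormality. -/
theorem sum_fuse (c : SpiderColor) (hn : n ≠ 0) (A B C D : Fin 4 → ℚ) :
    ∑ y : Fin n → Fin 4, (∑ g, A g * ((∏ i, basisVec c g (y i)) * B g)) *
        ∑ h, (C h * ∏ i, basisVec c h (y i)) * D h = ∑ g, C g * A g * (D g * B g) := by
  have key : ∀ g h : Fin 4,
      ∑ y : Fin n → Fin 4, (A g * ((∏ i, basisVec c g (y i)) * B g)) *
        ((C h * ∏ i, basisVec c h (y i)) * D h) =
          A g * B g * C h * D h * if g = h then 1 else 0 := by
    intro g h
    rw [← sum_prod_basisVec c g h hn, Finset.mul_sum]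
    exact Finset.sum_congr rfl fun y _ => by ring
  simp only [Finset.sum_mul_sum]
  rw [Finset.sum_comm]
  refine Finset.sum_congr rfl fun g _ => ?_
  rw [Finset.sum_comm]
  simp only [key, mul_ite, mul_one, mul_zero, Finset.sum_ite_eq, Finset.mem_univ, if_true]
  ring

/-- The same for a vertex whose common legs come first among its inputs. -/
theorem sum_fuse_dagger (c : SpiderColor) (hn : n ≠ 0) (A B C D : Fin 4 → ℚ) :
    ∑ y : Fin n → Fin 4, (∑ g, A g * (B g * ∏ i, basisVec c g (y i))) *
        ∑ h, ((∏ i, basisVec c h (y i)) * C h) * D h = ∑ g, A g * C g * (B g * D g) := by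
  have h := sum_fuse c hn A B C D
  calc _ = _ := by
        refine Finset.sum_congr rfl fun y _ => congrArg₂ _ ?_ ?_ <;>
          exact Finset.sum_congr rfl fun g _ => by ring
    _ = _ := h
    _ = _ := Finset.sum_congr rfl fun g _ => by ring

theorem eval_fuse (c : SpiderColor) (k₁ l₁ k₂ l₂ : ℕ) (hn : n ≠ 0) (x : Fin (k₁ + k₂) → Fin 4)
    (z : Fin (l₁ + l₂) → Fin 4) :
    eval (.comp (.tensor (.spider c (k₁ + n) l₁) (.strings l₂))
          (.comp (.stringsEq (Nat.add_assoc k₁ n l₂).symm)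
            (.tensor (.strings k₁) (.spider c k₂ (n + l₂))))) x z =
      eval (.spider c (k₁ + k₂) (l₁ + l₂)) x z := by
  have split : ∀ (u : Fin k₁ → Fin 4) (y : Fin n → Fin 4) (v : Fin l₂ → Fin 4),
      (fun i => Fin.append (Fin.append u y) v (Fin.cast (Nat.add_assoc k₁ n l₂).symm i)) =
        Fin.append u (Fin.append y v) := by
    intro u y v
    rw [Fin.append_assoc]
    rfl
  rw [eval_comp]
  simp only [eval_stringsEq_comp, sum_append, split]
  simp only [eval_tensor, eval_strings, eval_spider, Fin.append_left, Fin.append_right,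
    Fin.prod_univ_add, ite_mul, mul_ite, one_mul, mul_one, zero_mul, mul_zero,
    Finset.sum_ite_eq, Finset.sum_ite_eq', Finset.sum_ite_irrel, Finset.sum_const_zero,
    Finset.mem_univ, if_true]
  exact sum_fuse c hn _ _ _ _

theorem eval_fuse_dagger (c : SpiderColor) (k₁ l₁ k₂ l₂ : ℕ) (hn : n ≠ 0)
    (x : Fin (k₁ + k₂) → Fin 4) (z : Fin (l₁ + l₂) → Fin 4) :
    eval (.comp (.tensor (.strings l₁) (.spider c (n + k₂) l₂))
          (.comp (.stringsEq (Nat.add_assoc l₁ n k₂))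
            (.tensor (.spider c k₁ (l₁ + n)) (.strings k₂)))) x z =
      eval (.spider c (k₁ + k₂) (l₁ + l₂)) x z := by
  have split : ∀ (u : Fin l₁ → Fin 4) (y : Fin n → Fin 4) (v : Fin k₂ → Fin 4),
      (fun i => Fin.append u (Fin.append y v) (Fin.cast (Nat.add_assoc l₁ n k₂) i)) =
        Fin.append (Fin.append u y) v := by
    intro u y v
    rw [Fin.append_assoc]
    rfl
  rw [eval_comp]
  simp only [eval_stringsEq_comp, sum_append, split]
  simp only [eval_tensor, eval_strings, eval_spider, Fin.append_left, Fin.append_right,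
    Fin.prod_univ_add, ite_mul, mul_ite, one_mul, mul_one, zero_mul, mul_zero,
    Finset.sum_ite_eq, Finset.sum_ite_eq', Finset.sum_ite_irrel, Finset.sum_const_zero,
    Finset.mem_univ, if_true]
  exact sum_fuse_dagger c hn _ _ _ _

theorem eval_interchange (b : SpiderDiagram l m) (b' : SpiderDiagram l' m')
    (a : SpiderDiagram k l) (a' : SpiderDiagram k' l') (x : Fin (k + k') → Fin 4)
    (z : Fin (m + m') → Fin 4) :
    eval (.comp (.tensor b b') (.tensor a a')) x z =
      eval (.tensor (.comp b a) (.comp b' a')) x z := by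
  simp only [eval_comp, eval_tensor, sum_append, Fin.append_left, Fin.append_right,
    Finset.sum_mul_sum]
  exact Finset.sum_congr rfl fun u _ => Finset.sum_congr rfl fun v _ => by ring

theorem eval_strings_tensor_strings (x y : Fin (k + l) → Fin 4) :
    eval (.tensor (.strings k) (.strings l)) x y = eval (.strings (k + l)) x y := by
  simp only [eval_tensor, eval_strings]
  have h := append_eq_iff x (fun i => y (Fin.castAdd l i)) (fun i => y (Fin.natAdd k i))
  rw [Fin.append_castAdd_natAdd] at h
  by_cases hxy : x = y
  · simp [hxy]
  · rw [if_neg hxy]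
    split_ifs with h₁ h₂
    · exact absurd (h.2 ⟨h₁, h₂⟩) hxy
    all_goals simp

theorem eval_double (c : SpiderColor) (x z : Fin 1 → Fin 4) :
    eval (.comp (.spider c 2 1) (.spider c.swap 1 2)) x z =
      (4 : ℚ)⁻¹ * eval (.comp (.spider c 0 1) (.spider c.swap 1 0)) x z := by
  have h2 (f : (Fin 2 → Fin 4) → ℚ) : ∑ y, f y = ∑ s, ∑ t, f ![s, t] := by
    rw [← Fintype.sum_prod_type' (fun s t => f ![s, t])]
    exact (Fintype.sum_equiv (finTwoArrowEquiv (Fin 4)).symm _ _ fun _ => rfl).symm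
  have swap (F : Fin 4 → Fin 4 → Fin 4 → Fin 4 → ℚ) :
      ∑ s, ∑ t, ∑ g, ∑ h, F g h s t = ∑ g, ∑ h, ∑ s, ∑ t, F g h s t := by
    rw [Finset.sum_congr rfl fun s _ => Finset.sum_comm, Finset.sum_comm]
    refine Finset.sum_congr rfl fun g _ => ?_
    rw [Finset.sum_congr rfl fun s _ => Finset.sum_comm, Finset.sum_comm]
  have key (g h : Fin 4) : ∑ s, ∑ t, basisVec c.swap g (x 0) *
      (basisVec c.swap g s * basisVec c.swap g t) * (basisVec c h s * basisVec c h t *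
        basisVec c h (z 0)) = 4⁻¹ * (basisVec c.swap g (x 0) * basisVec c h (z 0)) := by
    have := basisVec_flat c h g
    rw [Finset.sum_mul_sum] at this
    rw [← one_div, ← this, Finset.sum_mul]
    refine Finset.sum_congr rfl fun s _ => ?_
    rw [Finset.sum_mul]
    exact Finset.sum_congr rfl fun t _ => by ring
  simp only [eval_comp, eval_spider, h2, Fin.prod_univ_two, Fin.prod_univ_one,
    Fin.prod_univ_zero, Matrix.cons_val_zero, Matrix.cons_val_one, mul_one, one_mul]
  simp only [Finset.univ_unique, Finset.sum_singleton]
  simp only [Finset.sum_mul_sum]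
  simp only [swap, key, Finset.mul_sum]

/-- A relation `d = z • d'` has `z = N ^ e` for an integer `e`, and the values in the model differ by
the factor `4 ^ e` with the same `e`. -/
theorem eval_rel (N : ℂ) {d d' : SpiderDiagram k l} {z : ℂ} (h : SpiderDiagram.Rel N d z d') :
    ∃ e : ℤ, z = N ^ e ∧ ∀ x y, eval d x y = 4 ^ e * eval d' x y := by
  induction h with
  | comp_left b _ ih =>
    obtain ⟨e, hz, he⟩ := ih
    exact ⟨e, hz, fun x y => by simp only [eval_comp, he, Finset.mul_sum, mul_assoc]⟩
  | comp_right a _ ih =>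
    obtain ⟨e, hz, he⟩ := ih
    exact ⟨e, hz, fun x y => by simp only [eval_comp, he, Finset.mul_sum, mul_left_comm]⟩
  | tensor_left a _ ih =>
    obtain ⟨e, hz, he⟩ := ih
    exact ⟨e, hz, fun x y => by simp only [eval_tensor, he, mul_left_comm]⟩
  | tensor_right b _ ih =>
    obtain ⟨e, hz, he⟩ := ih
    exact ⟨e, hz, fun x y => by simp only [eval_tensor, he, mul_assoc]⟩
  | strings_comp a => exact ⟨0, by simp, fun x y => by simp [eval_comp, eval_strings]⟩
  | comp_strings a => exact ⟨0, by simp, fun x y => by simp [eval_comp, eval_strings]⟩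
  | comp_assoc c b a =>
    refine ⟨0, by simp, fun x y => ?_⟩
    simp only [eval_comp, Finset.mul_sum, Finset.sum_mul, zpow_zero, one_mul, mul_assoc]
    exact Finset.sum_comm
  | strings_tensor_strings k l =>
    exact ⟨0, by simp, fun x y => by simp [eval_strings_tensor_strings]⟩
  | interchange b b' a a' => exact ⟨0, by simp, fun x y => by simp [eval_interchange]⟩
  | strings_zero_tensor a =>
    refine ⟨0, by simp, fun x y => ?_⟩
    rw [eval_stringsEq_comp, eval_comp_stringsEq, eval_tensor, eval_strings,
      if_pos (Subsingleton.elim _ _), zpow_zero, one_mul, one_mul]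
    congr 1 <;> funext i <;> congr 1 <;> (ext; simp)
  | tensor_strings_zero a =>
    refine ⟨0, by simp, fun x y => ?_⟩
    rw [eval_stringsEq_comp, eval_comp_stringsEq, eval_tensor, eval_strings,
      if_pos (Subsingleton.elim _ _), zpow_zero, one_mul, mul_one]
    rfl
  | tensor_assoc a b c =>
    refine ⟨0, by simp, fun x y => ?_⟩
    rw [eval_stringsEq_comp, eval_comp_stringsEq, zpow_zero, one_mul]
    simp only [eval_tensor, mul_assoc]
    congr 2 <;> congr 1 <;> funext i <;> congr 1 <;> (ext; simp [add_assoc])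
  | spider_zero c => exact ⟨1, by simp, fun x y => by simp [eval_spider, eval_strings,
      Subsingleton.elim x y]⟩
  | spider_one c =>
    refine ⟨0, by simp, fun x y => ?_⟩
    rw [eval_spider, eval_strings]
    simp only [Fin.prod_univ_one, basisVec_complete, zpow_zero, one_mul]
    exact if_congr (by simp [funext_iff]) rfl rfl
  | fuse c k₁ l₁ k₂ l₂ m =>
    exact ⟨0, by simp, fun x y => by
      rw [zpow_zero, one_mul]; exact eval_fuse c k₁ l₁ k₂ l₂ m.succ_ne_zero x y⟩
  | fuse_dagger c k₁ l₁ k₂ l₂ m =>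
    exact ⟨0, by simp, fun x y => by
      rw [zpow_zero, one_mul]; exact eval_fuse_dagger c k₁ l₁ k₂ l₂ m.succ_ne_zero x y⟩
  | cup =>
    exact ⟨0, by simp, fun x y => by
      simp only [eval_spider, Fin.prod_univ_two, Fin.prod_univ_zero, one_mul, zpow_zero,
        basisVec_complete]⟩
  | cap =>
    exact ⟨0, by simp, fun x y => by
      simp only [eval_spider, Fin.prod_univ_two, Fin.prod_univ_zero, one_mul, mul_one, zpow_zero,
        basisVec_complete]⟩
  | double c =>
    exact ⟨-1, by simp, fun x y => by rw [zpow_neg_one]; exact eval_double c x y⟩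

end NCBipart.Model

namespace NCBipart

variable {N : ℂ}

/-- The functional on `NCBipart_N(0, 0)` that sends a closed diagram with value `4 ^ e` in the model
to `N ^ e` and the other closed diagrams to `0`. The exponent is written as `Int.log 4`, which recovers
`e` from `4 ^ e`. -/
noncomputable def unitFunctional (hN : N ≠ 0) : Hom N 0 0 →ₗ[ℂ] ℂ :=
  lift (fun d =>
      let v := Model.eval d Fin.elim0 Fin.elim0
      if v = 4 ^ Int.log 4 v then N ^ Int.log 4 v else 0) (by
    intro d d' z h
    obtain ⟨e, rfl, he⟩ := Model.eval_rel N h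
    have log_zpow (j : ℤ) : Int.log 4 ((4 : ℚ) ^ j) = j := by
      exact_mod_cast Int.log_zpow (R := ℚ) (b := 4) (by norm_num) j
    simp only [he, smul_eq_mul]
    generalize Model.eval d' Fin.elim0 Fin.elim0 = v
    by_cases hv : v = 4 ^ Int.log 4 v
    · generalize Int.log 4 v = j at hv
      subst hv
      rw [← zpow_add₀ (by norm_num), log_zpow, if_pos rfl, if_pos rfl, zpow_add₀ hN]
    · rw [if_neg hv, mul_zero, if_neg]
      intro h
      generalize Int.log 4 (4 ^ e * v) = j at h
      have hv' : v = 4 ^ (-e + j) := by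
        rw [zpow_add₀ (by norm_num), ← h, ← mul_assoc, ← zpow_add₀ (by norm_num)]
        simp
      rw [hv', log_zpow] at hv
      exact hv rfl)

theorem unitFunctional_strings (hN : N ≠ 0) :
    unitFunctional hN (ofDiagram N (.strings 0)) = 1 := by
  have h : Model.eval (.strings 0) Fin.elim0 Fin.elim0 = 1 := by simp [Model.eval_strings]
  simp [unitFunctional, h]

theorem ofDiagram_strings_zero_ne_zero (hN : N ≠ 0) : ofDiagram N (.strings 0) ≠ 0 := fun h => by
  simpa [h] using unitFunctional_strings hN

end NCBipart

/-! ### Compression in Temperley–Lieb algebras -/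

namespace TemperleyLieb

variable {R : Type*} [Ring R] [Algebra ℂ R]

/-- If `q T q ⊆ T q`, then `T + T q T` is closed under multiplication, so it contains the algebra
generated by `T` and `q`. -/
theorem mem_of_mem_adjoin_insert (T : Subalgebra ℂ R) (q : R)
    (hq : ∀ t ∈ T, ∃ t' ∈ T, q * t * q = t' * q) {x : R}
    (hx : x ∈ Algebra.adjoin ℂ (insert q (T : Set R))) :
    x ∈ Subalgebra.toSubmodule T ⊔
      Subalgebra.toSubmodule T * Submodule.span ℂ {q} * Subalgebra.toSubmodule T := by
  set S := Subalgebra.toSubmodule T with hS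
  set Q := Submodule.span ℂ {q} with hQ
  have hTT : S * S = S := T.isIdempotentElem_toSubmodule
  have hQTQ : Q * S * Q ≤ S * Q := by
    rw [Submodule.mul_le]
    intro y hy y' hy'
    obtain ⟨b, rfl⟩ := Submodule.mem_span_singleton.1 hy'
    refine Submodule.mul_induction_on hy (fun m hm n hn => ?_) fun y z hy hz => ?_
    · obtain ⟨a, rfl⟩ := Submodule.mem_span_singleton.1 hm
      obtain ⟨t, ht, h⟩ := hq n hn
      have : a • q * n * b • q = (a * b) • (t * q) := by
        rw [← h, mul_smul_comm, smul_mul_assoc, smul_mul_assoc, smul_smul, mul_comm]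
      rw [this]
      exact Submodule.smul_mem _ _
        (Submodule.mul_mem_mul ht (Submodule.mem_span_singleton_self q))
    · rw [add_mul]; exact add_mem hy hz
  have hmul : (S ⊔ S * Q * S) * (S ⊔ S * Q * S) ≤ S ⊔ S * Q * S := by
    have h₁ : S * (S * Q * S) = S * Q * S := by rw [← mul_assoc, ← mul_assoc, hTT]
    have h₂ : S * Q * S * S = S * Q * S := by rw [mul_assoc, hTT]
    have h₃ : S * Q * S * (S * Q * S) ≤ S * Q * S := by
      calc S * Q * S * (S * Q * S) = S * (Q * (S * S) * Q) * S := by simp only [mul_assoc]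
        _ ≤ S * (S * Q) * S := by
          rw [hTT]; exact mul_le_mul' (mul_le_mul' le_rfl hQTQ) le_rfl
        _ = S * Q * S := by rw [← mul_assoc, hTT]
    simp only [Submodule.sup_mul, Submodule.mul_sup, hTT, h₁, h₂]
    exact sup_le (sup_le le_sup_left le_sup_right) (sup_le le_sup_right (h₃.trans le_sup_right))
  have hone : (1 : R) ∈ S := one_mem T
  induction hx using Algebra.adjoin_induction with
  | mem x hx =>
    rcases hx with rfl | hx
    · refine Submodule.mem_sup_right ?_
      have := Submodule.mul_mem_mul (Submodule.mul_mem_mul hone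
        (Submodule.mem_span_singleton_self x)) hone
      simpa using this
    · exact Submodule.mem_sup_left hx
  | algebraMap r => exact Submodule.mem_sup_left (algebraMap_mem T r)
  | add x y _ _ hx hy => exact add_mem hx hy
  | mul x y _ _ hx hy => exact hmul (Submodule.mul_mem_mul hx hy)

/-- Since the algebra generated by `T` and `q` is `T + T q T`, compression by `p` maps it to `T' p`
as soon as it does so with `T` and `T q T`. -/
theorem compress_adjoin_insert {T T' : Subalgebra ℂ R} {p q : R}
    (hq : ∀ t ∈ T, ∃ t' ∈ T, q * t * q = t' * q)
    (hp : ∀ t ∈ T, ∃ t' ∈ T', p * t * p = t' * p)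
    (h : ∀ s ∈ T, ∀ t ∈ T, ∃ t' ∈ T', p * (s * q * t) * p = t' * p) {x : R}
    (hx : x ∈ Algebra.adjoin ℂ (insert q (T : Set R))) : ∃ t ∈ T', p * x * p = t * p := by
  have add {x y : R} (hx : ∃ t ∈ T', p * x * p = t * p) (hy : ∃ t ∈ T', p * y * p = t * p) :
      ∃ t ∈ T', p * (x + y) * p = t * p := by
    obtain ⟨s, hs, hx⟩ := hx
    obtain ⟨t, ht, hy⟩ := hy
    exact ⟨s + t, add_mem hs ht, by rw [mul_add, add_mul, hx, hy, add_mul]⟩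
  obtain ⟨t, ht, w, hw, rfl⟩ := Submodule.mem_sup.1 (mem_of_mem_adjoin_insert T q hq hx)
  refine add (hp t ht) ?_
  refine Submodule.mul_induction_on hw (fun m hm n hn => ?_) fun _ _ => add
  refine Submodule.mul_induction_on hm (fun m hm r hr => ?_) fun y y' hy hy' => ?_
  · obtain ⟨a, rfl⟩ := Submodule.mem_span_singleton.1 hr
    obtain ⟨t, ht, e⟩ := h m hm n hn
    exact ⟨a • t, T'.smul_mem ht a, by
      rw [smul_mul_assoc, ← e, mul_smul_comm, smul_mul_assoc, mul_smul_comm, smul_mul_assoc]⟩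
  · rw [add_mul]; exact add hy hy'

/-- The algebra on `m` strands, generated by the `a j` with `j + 1 < m`; `a j` acts on the strands
`j` and `j + 1`. -/
def strandAlgebra (a : ℕ → R) (m : ℕ) : Subalgebra ℂ R :=
  Algebra.adjoin ℂ {x | ∃ j, j + 1 < m ∧ x = a j}

theorem strandAlgebra_mono (a : ℕ → R) {m n : ℕ} (h : m ≤ n) :
    strandAlgebra a m ≤ strandAlgebra a n :=
  Algebra.adjoin_mono fun _ ⟨j, hj, hx⟩ => ⟨j, hj.trans_le h, hx⟩

theorem strandAlgebra_succ_le (a : ℕ → R) (m : ℕ) :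
    strandAlgebra a (m + 2) ≤
      Algebra.adjoin ℂ (insert (a m) (strandAlgebra a (m + 1) : Set R)) := by
  refine Algebra.adjoin_le ?_
  rintro _ ⟨j, hj, rfl⟩
  refine Algebra.subset_adjoin ?_
  rcases (show j = m ∨ j + 1 < m + 1 by omega) with rfl | hj
  · exact Set.mem_insert _ _
  · exact Set.mem_insert_of_mem _ (Algebra.subset_adjoin ⟨j, hj, rfl⟩)

theorem commute_strandAlgebra {a : ℕ → R} {m : ℕ} {y : R}
    (h : ∀ j, j + 1 < m → Commute y (a j)) {x : R} (hx : x ∈ strandAlgebra a m) :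
    Commute y x := by
  have := Algebra.adjoin_le (S := Subalgebra.centralizer ℂ {y})
    (s := {x | ∃ j, j + 1 < m ∧ x = a j}) (by
      rintro _ ⟨j, hj, rfl⟩
      rw [SetLike.mem_coe, Subalgebra.mem_centralizer_iff]
      rintro _ rfl
      exact h j hj) hx
  exact (Subalgebra.mem_centralizer_iff ℂ).1 this y rfl

/-- The elements `a 0, …, a (n - 2)` satisfy the relations of the idempotent generators of the
Temperley–Lieb algebra on `n` strands with parameter `z`. Of the two cubic relations only the one
used below is kept. -/
structure IsGenerators (a : ℕ → R) (n : ℕ) (z : ℂ) : Prop where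
  idem (j : ℕ) (hj : j + 1 < n) : a j * a j = a j
  cubic (j : ℕ) (hj : j + 2 < n) : a (j + 1) * a j * a (j + 1) = z • a (j + 1)
  far (i j : ℕ) (hij : i + 2 ≤ j) (hj : j + 1 < n) : Commute (a j) (a i)

variable {a b : ℕ → R} {n : ℕ} {z : ℂ}

/-- The conditional expectation: compressing the algebra on `m + 1` strands by `a m` leads to the
algebra on `m` strands. -/
theorem compress_of_mem_strandAlgebra_succ (ha : IsGenerators a n z) {m : ℕ} (hm : m + 1 < n) :
    ∀ x ∈ strandAlgebra a (m + 1), ∃ t ∈ strandAlgebra a m, a m * x * a m = t * a m := by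
  induction m with
  | zero =>
    intro x hx
    have : x ∈ (⊥ : Subalgebra ℂ R) := by
      rw [← Algebra.adjoin_empty]
      exact Algebra.adjoin_mono (by rintro _ ⟨j, hj, -⟩; omega) hx
    obtain ⟨r, rfl⟩ := Algebra.mem_bot.1 this
    exact ⟨_, algebraMap_mem _ r, by rw [← Algebra.commutes, mul_assoc, ha.idem 0 hm]⟩
  | succ m ih =>
    have comm {t : R} (ht : t ∈ strandAlgebra a (m + 1)) : Commute (a (m + 1)) t :=
      commute_strandAlgebra (fun j hj => ha.far _ _ (by omega) hm) ht
    intro x hx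
    refine compress_adjoin_insert (fun t ht => ?_) (fun t ht => ?_)
      (fun s hs t ht => ?_) (strandAlgebra_succ_le a m hx)
    · obtain ⟨t', ht', h⟩ := ih (by omega) t ht
      exact ⟨t', strandAlgebra_mono a (by omega) ht', h⟩
    · exact ⟨t, ht, by rw [(comm ht).eq, mul_assoc, ha.idem _ hm]⟩
    · refine ⟨z • (s * t), Subalgebra.smul_mem _ (mul_mem hs ht) z, ?_⟩
      calc a (m + 1) * (s * a m * t) * a (m + 1)
          = (a (m + 1) * s) * a m * (t * a (m + 1)) := by simp only [mul_assoc]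
        _ = s * (a (m + 1) * a m * a (m + 1)) * t := by
          rw [(comm hs).eq, ← (comm ht).eq]; simp only [mul_assoc]
        _ = z • (s * t) * a (m + 1) := by
          rw [ha.cubic m (by omega), mul_smul_comm, smul_mul_assoc, mul_assoc, (comm ht).eq,
            smul_mul_assoc, mul_assoc]

/-- Compressing the algebra on `m + 2` strands, which contains `a m`, by `a m` leads to the algebra
on `m` strands. -/
theorem compress_of_mem_strandAlgebra (ha : IsGenerators a n z) {m : ℕ} (hm : m + 1 < n) {x : R}
    (hx : x ∈ strandAlgebra a (m + 2)) :
    ∃ t ∈ strandAlgebra a m, a m * x * a m = t * a m := by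
  have hc := compress_of_mem_strandAlgebra_succ ha hm
  have comm {t : R} (ht : t ∈ strandAlgebra a m) : Commute (a m) t :=
    commute_strandAlgebra (fun j hj => ha.far _ _ (by omega) hm) ht
  have hle := strandAlgebra_mono a m.le_succ
  refine compress_adjoin_insert
    (fun t ht => let ⟨t', ht', h⟩ := hc t ht; ⟨t', hle ht', h⟩) hc
    (fun s hs t ht => ?_) (strandAlgebra_succ_le a m hx)
  obtain ⟨s', hs', es⟩ := hc s hs
  obtain ⟨t', ht', et⟩ := hc t ht
  refine ⟨s' * t', mul_mem hs' ht', ?_⟩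
  calc a m * (s * a m * t) * a m = a m * s * (a m * t * a m) := by simp only [mul_assoc]
    _ = (a m * s * a m) * t' := by rw [et, ← (comm ht').eq]; simp only [mul_assoc]
    _ = s' * t' * a m := by rw [es, mul_assoc, (comm ht').eq, mul_assoc]

/-- If `F` absorbs `a 0, a 2, a 4, …`, then an element on `2 r` strands between two copies of `F` can
be compressed by `a (2 r - 2)`, which removes two strands, until only a scalar is left. The factor `y`
comes along because it commutes with the whole family. -/
theorem exists_smul_of_absorbs (ha : IsGenerators a n z) {F y : R}
    (hy : ∀ j, j + 1 < n → Commute y (a j))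
    (left : ∀ i, 2 * i + 1 < n → a (2 * i) * F = F)
    (right : ∀ i, 2 * i + 1 < n → F * a (2 * i) = F) (r : ℕ) (hr : 2 * r ≤ n) {x : R}
    (hx : x ∈ strandAlgebra a (2 * r)) : ∃ w : ℂ, F * x * y * F = w • (F * y * F) := by
  induction r generalizing x with
  | zero =>
    have : x ∈ (⊥ : Subalgebra ℂ R) := by
      rw [← Algebra.adjoin_empty]
      exact Algebra.adjoin_mono (by rintro _ ⟨j, hj, -⟩; omega) hx
    obtain ⟨w, rfl⟩ := Algebra.mem_bot.1 this
    exact ⟨w, by rw [← Algebra.commutes, mul_assoc, mul_assoc, Algebra.smul_def, mul_assoc]⟩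
  | succ r ih =>
    obtain ⟨t, ht, h⟩ := compress_of_mem_strandAlgebra ha (m := 2 * r) (by omega) hx
    obtain ⟨w, hw⟩ := ih (by omega) ht
    refine ⟨w, ?_⟩
    have hl := left r (by omega)
    have hc : Commute y (a (2 * r)) := hy _ (by omega)
    calc F * x * y * F = F * a (2 * r) * x * y * (a (2 * r) * F) := by
          rw [right r (by omega), hl]
      _ = F * (a (2 * r) * x * (y * a (2 * r))) * F := by simp only [mul_assoc]
      _ = F * (a (2 * r) * x * a (2 * r)) * y * F := by rw [hc.eq]; simp only [mul_assoc]
      _ = F * t * (a (2 * r) * y) * F := by rw [h]; simp only [mul_assoc]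
      _ = F * t * y * (a (2 * r) * F) := by rw [← hc.eq]; simp only [mul_assoc]
      _ = w • (F * y * F) := by rw [hl, hw]

/-- For commuting subalgebras `A` and `B`, the algebra they generate is the span of the products
`x * y` with `x ∈ A` and `y ∈ B`. -/
theorem mem_mul_of_mem_adjoin {A B : Subalgebra ℂ R} (h : ∀ x ∈ A, ∀ y ∈ B, Commute x y) {s : Set R}
    (hs : ∀ x ∈ s, x ∈ A ∨ x ∈ B) {x : R} (hx : x ∈ Algebra.adjoin ℂ s) :
    x ∈ Subalgebra.toSubmodule A * Subalgebra.toSubmodule B := by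
  have hA {x : R} (hx : x ∈ A) : x ∈ Subalgebra.toSubmodule A * Subalgebra.toSubmodule B := by
    simpa using Submodule.mul_mem_mul (show x ∈ Subalgebra.toSubmodule A from hx)
      (show (1 : R) ∈ Subalgebra.toSubmodule B from one_mem B)
  have hB {x : R} (hx : x ∈ B) : x ∈ Subalgebra.toSubmodule A * Subalgebra.toSubmodule B := by
    simpa using Submodule.mul_mem_mul (show (1 : R) ∈ Subalgebra.toSubmodule A from one_mem A)
      (show x ∈ Subalgebra.toSubmodule B from hx)
  induction hx using Algebra.adjoin_induction with
  | mem x hx => exact (hs x hx).elim hA hB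
  | algebraMap r => exact hA (algebraMap_mem A r)
  | add x y _ _ hx hy => exact add_mem hx hy
  | mul x y _ _ hx hy =>
    have hle : Subalgebra.toSubmodule B * Subalgebra.toSubmodule A ≤
        Subalgebra.toSubmodule A * Subalgebra.toSubmodule B := by
      rw [Submodule.mul_le]
      intro y hy x hx
      rw [← (h x hx y hy).eq]
      exact Submodule.mul_mem_mul hx hy
    have := Submodule.mul_mem_mul hx hy
    rw [mul_assoc, ← mul_assoc (Subalgebra.toSubmodule B)] at this
    have := mul_le_mul' le_rfl (mul_le_mul' hle le_rfl) this
    rwa [mul_assoc, B.isIdempotentElem_toSubmodule, ← mul_assoc,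
      A.isIdempotentElem_toSubmodule] at this

/-- If `F` absorbs the even generators of two commuting Temperley–Lieb families, then every element of
the algebra generated by both becomes a scalar between two copies of `F`. -/
theorem exists_smul_of_absorbs_pair (ha : IsGenerators a n z) (hb : IsGenerators b n z)
    (hab : ∀ i j, i + 1 < n → j + 1 < n → Commute (a i) (b j)) {F : R} {r : ℕ} (hn : n = 2 * r)
    (ha₁ : ∀ i, 2 * i + 1 < n → a (2 * i) * F = F) (ha₂ : ∀ i, 2 * i + 1 < n → F * a (2 * i) = F)
    (hb₁ : ∀ i, 2 * i + 1 < n → b (2 * i) * F = F) (hb₂ : ∀ i, 2 * i + 1 < n → F * b (2 * i) = F)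
    {x : R} (hx : x ∈ Algebra.adjoin ℂ {x | ∃ j, j + 1 < n ∧ (x = a j ∨ x = b j)}) :
    ∃ w : ℂ, F * x * F = w • (F * F) := by
  have comm : ∀ y ∈ strandAlgebra b n, ∀ i, i + 1 < n → Commute y (a i) := fun y hy i hi =>
    (commute_strandAlgebra (fun j hj => hab i j hi hj) hy).symm
  have mem := mem_mul_of_mem_adjoin (A := strandAlgebra a n) (B := strandAlgebra b n)
    (fun x hx y hy => (commute_strandAlgebra (comm y hy) hx).symm)
    (by
      rintro _ ⟨j, hj, rfl | rfl⟩
      · exact Or.inl (Algebra.subset_adjoin ⟨j, hj, rfl⟩)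
      · exact Or.inr (Algebra.subset_adjoin ⟨j, hj, rfl⟩)) hx
  refine Submodule.mul_induction_on mem (fun x hx y hy => ?_) ?_
  · obtain ⟨v, hv⟩ := exists_smul_of_absorbs ha (comm y hy) ha₁ ha₂ r hn.ge (hn ▸ hx)
    obtain ⟨w, hw⟩ := exists_smul_of_absorbs (y := 1) hb (fun _ _ => Commute.one_left _) hb₁ hb₂ r
      hn.ge (hn ▸ hy)
    rw [mul_one, mul_one] at hw
    exact ⟨v * w, by rw [← mul_assoc, hv, hw, smul_smul]⟩
  · rintro x y ⟨v, hv⟩ ⟨w, hw⟩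
    exact ⟨v + w, by rw [mul_add, add_mul, hv, hw, add_smul]⟩

end TemperleyLieb

/-! ### Spider calculus with few legs -/

namespace NCBipart

variable {N : ℂ} {k l m n k' l' m' : ℕ}

-- Keeps unification from unfolding morphisms to quotients when it compares sums of natural numbers.
attribute [local irreducible] comp tensor ofDiagram

/-- The identity of `k`, as a morphism. -/
noncomputable abbrev strand (N : ℂ) (k : ℕ) : Hom N k k := ofDiagram N (.strings k)

/-- A single vertex of colour `c`, as a morphism. -/
noncomputable abbrev vertex (N : ℂ) (c : SpiderColor) (k l : ℕ) : Hom N k l :=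
  ofDiagram N (.spider c k l)

/-- Parallel strings between two equal numbers, as a morphism. -/
noncomputable abbrev eqStrand (N : ℂ) (h : k = l) : Hom N k l := ofDiagram N (.stringsEq h)

theorem strand_tensor_strand (k l : ℕ) : tensor (strand N k) (strand N l) = strand N (k + l) :=
  stringsEq_tensor rfl rfl

theorem tensor_strand_zero (x : Hom N k l) : tensor x (strand N 0) = x :=
  (strings_comp _).symm.trans ((tensor_strings_zero x).trans (comp_strings x))

theorem strand_zero_tensor (x : Hom N k l) : tensor (strand N 0) x =
    comp (eqStrand N (Nat.zero_add l).symm) (comp x (eqStrand N (Nat.zero_add k))) := by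
  rw [← strings_zero_tensor, ← comp_assoc, stringsEq_comp]
  exact (strings_comp _).symm

-- If the arities of the right factor are numerals, both sides of the associativity law have the same
-- type by definition, and no transport is needed. For this reason positions are counted from the right
-- below.

theorem tensor_assoc_strand (x : Hom N k l) (y : Hom N k' l') :
    tensor (tensor x y) (strand N 1) = tensor x (tensor y (strand N 1)) :=
  (strings_comp _).symm.trans ((tensor_assoc x y _).trans (comp_strings _))

theorem tensor_assoc_two_two (x : Hom N k l) (y : Hom N k' l') (z : Hom N 2 2) :
    tensor (tensor x y) z = tensor x (tensor y z) :=
  (strings_comp _).symm.trans ((tensor_assoc x y z).trans (comp_strings _))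

theorem tensor_assoc_zero_two (x : Hom N k l) (y : Hom N k' l') (z : Hom N 0 2) :
    tensor (tensor x y) z = tensor x (tensor y z) :=
  (strings_comp _).symm.trans ((tensor_assoc x y z).trans (comp_strings _))

theorem tensor_assoc_two_zero (x : Hom N k l) (y : Hom N k' l') (z : Hom N 2 0) :
    tensor (tensor x y) z = tensor x (tensor y z) :=
  (strings_comp _).symm.trans ((tensor_assoc x y z).trans (comp_strings _))

theorem tensor_assoc_one_two (x : Hom N k l) (y : Hom N k' l') (z : Hom N 1 2) :
    tensor (tensor x y) z = tensor x (tensor y z) :=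
  (strings_comp _).symm.trans ((tensor_assoc x y z).trans (comp_strings _))

theorem tensor_assoc_two_one (x : Hom N k l) (y : Hom N k' l') (z : Hom N 2 1) :
    tensor (tensor x y) z = tensor x (tensor y z) :=
  (strings_comp _).symm.trans ((tensor_assoc x y z).trans (comp_strings _))

theorem tensor_strand_comp (n : ℕ) (x : Hom N l m) (y : Hom N k l) :
    comp (tensor x (strand N n)) (tensor y (strand N n)) = tensor (comp x y) (strand N n) := by
  rw [interchange, strings_comp]

theorem strand_tensor_comp (n : ℕ) (x : Hom N l m) (y : Hom N k l) :
    comp (tensor (strand N n) x) (tensor (strand N n) y) = tensor (strand N n) (comp x y) := by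
  rw [interchange, strings_comp]

theorem comp_tensor_strand_strand_tensor (x : Hom N k l) (y : Hom N k' l') :
    comp (tensor x (strand N l')) (tensor (strand N k) y) = tensor x y := by
  rw [interchange, strings_comp, comp_strings]

theorem comp_strand_tensor_tensor_strand (x : Hom N k l) (y : Hom N k' l') :
    comp (tensor (strand N l) y) (tensor x (strand N k')) = tensor x y := by
  rw [interchange, strings_comp, comp_strings]

theorem vertex_comp_eqStrand (c : SpiderColor) (h : k = l) :
    comp (vertex N c l m) (eqStrand N h) = vertex N c k m := by
  subst h; exact comp_strings _

theorem fuse (c : SpiderColor) (k₁ l₁ k₂ l₂ m : ℕ) :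
    comp (tensor (vertex N c (k₁ + (m + 1)) l₁) (strand N l₂))
      (comp (eqStrand N (Nat.add_assoc k₁ (m + 1) l₂).symm)
        (tensor (strand N k₁) (vertex N c k₂ ((m + 1) + l₂)))) =
      vertex N c (k₁ + k₂) (l₁ + l₂) := by
  simpa using ofDiagram_eq_one (.fuse c k₁ l₁ k₂ l₂ m)

theorem fuse_dagger (c : SpiderColor) (k₁ l₁ k₂ l₂ m : ℕ) :
    comp (tensor (strand N l₁) (vertex N c ((m + 1) + k₂) l₂))
      (comp (eqStrand N (Nat.add_assoc l₁ (m + 1) k₂))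
        (tensor (vertex N c k₁ (l₁ + (m + 1))) (strand N k₂))) =
      vertex N c (k₁ + k₂) (l₁ + l₂) := by
  simpa using ofDiagram_eq_one (.fuse_dagger c k₁ l₁ k₂ l₂ m)

theorem vertex_comp_vertex (c : SpiderColor) (k m l : ℕ) :
    comp (vertex N c (m + 1) l) (vertex N c k (m + 1)) = vertex N c k l := by
  have h := fuse (N := N) c 0 l k 0 m
  rw [tensor_strand_zero, strand_zero_tensor] at h
  have h' := congrArg (fun x => comp x (eqStrand N (Nat.zero_add k).symm)) h
  simp only [comp_assoc] at h'
  rw [stringsEq_comp] at h'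
  refine Eq.trans ?_ (h'.trans (vertex_comp_eqStrand c _))
  rw [vertex_comp_eqStrand, ← comp_assoc (eqStrand N _) (eqStrand N _), stringsEq_comp,
    ← comp_assoc]
  exact congrArg (fun x => comp x (vertex N c k (m + 1)))
    (vertex_comp_eqStrand c (Nat.zero_add (m + 1)).symm).symm

theorem vertex_one_one (c : SpiderColor) : vertex N c 1 1 = strand N 1 :=
  ofDiagram_eq_one (.spider_one c)

theorem vertex_zero_two (c c' : SpiderColor) : vertex N c 0 2 = vertex N c' 0 2 := by
  have h : vertex N .black 0 2 = vertex N .white 0 2 := ofDiagram_eq_one .cup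
  cases c <;> cases c' <;> simp [h]

theorem vertex_two_zero (c c' : SpiderColor) : vertex N c 2 0 = vertex N c' 2 0 := by
  have h : vertex N .black 2 0 = vertex N .white 2 0 := ofDiagram_eq_one .cap
  cases c <;> cases c' <;> simp [h]

/-- A closed loop has the value `N`. -/
theorem cap_comp_cup (c c' : SpiderColor) :
    comp (vertex N c 2 0) (vertex N c' 0 2) = N • strand N 0 := by
  rw [vertex_zero_two c' c, vertex_comp_vertex]
  exact ofDiagram_eq (.spider_zero c)

theorem double (c : SpiderColor) : comp (vertex N c 2 1) (vertex N c.swap 1 2) =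
    N⁻¹ • comp (vertex N c 0 1) (vertex N c.swap 1 0) := by
  simpa using ofDiagram_eq (N := N) (.double c)

/-- The cap followed by the cup. -/
noncomputable def turn (N : ℂ) : Hom N 2 2 := comp (vertex N .black 0 2) (vertex N .black 2 0)

/-- Splitting both vertices in two exposes a double string between the two colours, which is cut. -/
theorem vertex_comp_vertex_swap (c : SpiderColor) :
    comp (vertex N c 2 2) (vertex N c.swap 2 2) = N⁻¹ • turn N := by
  calc comp (vertex N c 2 2) (vertex N c.swap 2 2)
      = comp (comp (vertex N c 1 2) (vertex N c 2 1))
          (comp (vertex N c.swap 1 2) (vertex N c.swap 2 1)) := by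
        rw [vertex_comp_vertex c 2 0 2, vertex_comp_vertex c.swap 2 0 2]
    _ = comp (vertex N c 1 2)
          (comp (comp (vertex N c 2 1) (vertex N c.swap 1 2)) (vertex N c.swap 2 1)) := by
        simp only [comp_assoc]
    _ = N⁻¹ • comp (comp (vertex N c 1 2) (vertex N c 0 1))
          (comp (vertex N c.swap 1 0) (vertex N c.swap 2 1)) := by
        rw [double]; simp only [map_smul, LinearMap.smul_apply, comp_assoc]
    _ = N⁻¹ • turn N := by
        rw [vertex_comp_vertex c 0 0 2, vertex_comp_vertex c.swap 2 0 0, turn,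
          vertex_zero_two c .black, vertex_two_zero c.swap .black]

theorem zigzag (c : SpiderColor) :
    comp (tensor (strand N 1) (vertex N c 2 0)) (tensor (vertex N c 0 2) (strand N 1)) =
      strand N 1 :=
  (congrArg (comp _) (strings_comp _).symm).trans
    ((fuse_dagger c 0 1 1 0 0).trans (vertex_one_one c))

theorem zigzag' (c : SpiderColor) :
    comp (tensor (vertex N c 2 0) (strand N 1)) (tensor (strand N 1) (vertex N c 0 2)) =
      strand N 1 :=
  (congrArg (comp _) (strings_comp _).symm).trans
    ((fuse c 1 0 0 1 0).trans (vertex_one_one c))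

theorem commute_neighbours (c : SpiderColor) :
    comp (tensor (strand N 1) (vertex N c 2 2)) (tensor (vertex N c 2 2) (strand N 1)) =
      comp (tensor (vertex N c 2 2) (strand N 1)) (tensor (strand N 1) (vertex N c 2 2)) :=
  ((congrArg (comp _) (strings_comp _).symm).trans (fuse_dagger c 2 1 1 2 0)).trans
    ((congrArg (comp _) (strings_comp _).symm).trans (fuse c 1 2 2 1 0)).symm

/-- A bigon between a vertex of colour `c` on the left and a three-legged vertex of the other colour on
its right. Bending the left side of the bigon to the top turns it into the double string of the
relation `double`. -/
theorem cut_bigon (c : SpiderColor) :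
    comp (comp (tensor (vertex N c 2 1) (strand N 1))
        (tensor (strand N 1) (vertex N c.swap 1 2))) (vertex N c 1 2) =
      N⁻¹ • tensor (strand N 1) (vertex N c.swap 0 1) := by
  have bend : vertex N c 2 1 = comp (tensor (strand N 1) (vertex N c 2 0))
      (tensor (vertex N c 1 2) (strand N 1)) :=
    ((congrArg (comp _) (strings_comp _).symm).trans (fuse_dagger c 1 1 1 0 0)).symm
  have assoc : comp (tensor (vertex N c 1 2) (strand N 1)) (vertex N c 1 2) =
      comp (tensor (strand N 1) (vertex N c 1 2)) (vertex N c 1 2) := by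
    have h₁ : comp (tensor (vertex N c 1 2) (strand N 1)) (vertex N c 1 2) = vertex N c 1 3 := by
      have := fuse (N := N) c 0 2 1 1 0
      rw [strand_zero_tensor] at this
      exact (congrArg (comp _) ((strings_comp _).symm.trans (congrArg (comp _)
        ((strings_comp _).symm.trans (congrArg (comp _) (comp_strings _).symm))))).trans this
    have h₂ : comp (tensor (strand N 1) (vertex N c 1 2)) (vertex N c 1 2) = vertex N c 1 3 := by
      have := fuse_dagger (N := N) c 1 1 0 2 0
      rw [tensor_strand_zero] at this
      exact (congrArg (comp _) (strings_comp _).symm).trans this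
    rw [h₁, h₂]
  have rotate : comp (tensor (vertex N c 2 0) (strand N 1))
      (tensor (strand N 1) (vertex N c.swap 1 2)) = vertex N c.swap 2 1 := by
    rw [vertex_two_zero c c.swap]
    exact (congrArg (comp _) (strings_comp _).symm).trans (fuse c.swap 1 0 1 1 0)
  have far : comp (tensor (tensor (vertex N c 1 2) (strand N 1)) (strand N 1))
      (tensor (strand N 1) (vertex N c.swap 1 2)) =
      comp (tensor (strand N 2) (vertex N c.swap 1 2)) (tensor (vertex N c 1 2) (strand N 1)) := by
    rw [tensor_assoc_strand, strand_tensor_strand]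
    exact (comp_tensor_strand_strand_tensor (vertex N c 1 2) (vertex N c.swap 1 2)).trans
      (comp_strand_tensor_tensor_strand (vertex N c 1 2) (vertex N c.swap 1 2)).symm
  have swap_double : comp (vertex N c.swap 2 1) (vertex N c 1 2) =
      N⁻¹ • comp (vertex N c.swap 0 1) (vertex N c 1 0) := by
    cases c
    · exact double .white
    · exact double .black
  have assoc' : tensor (strand N 2) (vertex N c.swap 1 2) =
      tensor (strand N 1) (tensor (strand N 1) (vertex N c.swap 1 2)) := by
    rw [← tensor_assoc_one_two, strand_tensor_strand]
  rw [bend, ← tensor_strand_comp]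
  calc comp (comp (comp (tensor (tensor (strand N 1) (vertex N c 2 0)) (strand N 1))
        (tensor (tensor (vertex N c 1 2) (strand N 1)) (strand N 1)))
        (tensor (strand N 1) (vertex N c.swap 1 2))) (vertex N c 1 2)
      = comp (tensor (tensor (strand N 1) (vertex N c 2 0)) (strand N 1))
          (comp (comp (tensor (tensor (vertex N c 1 2) (strand N 1)) (strand N 1))
          (tensor (strand N 1) (vertex N c.swap 1 2))) (vertex N c 1 2)) := by
        rw [comp_assoc, comp_assoc, comp_assoc]
    _ = comp (tensor (strand N 1) (tensor (vertex N c 2 0) (strand N 1)))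
          (comp (tensor (strand N 1) (tensor (strand N 1) (vertex N c.swap 1 2)))
          (comp (tensor (strand N 1) (vertex N c 1 2)) (vertex N c 1 2))) := by
        rw [far, comp_assoc, assoc, assoc', tensor_assoc_strand]
    _ = comp (tensor (strand N 1) (comp (comp (tensor (vertex N c 2 0) (strand N 1))
          (tensor (strand N 1) (vertex N c.swap 1 2))) (vertex N c 1 2))) (vertex N c 1 2) := by
        rw [← strand_tensor_comp, ← strand_tensor_comp, comp_assoc, comp_assoc]
    _ = N⁻¹ • comp (tensor (strand N 1) (comp (vertex N c.swap 0 1) (vertex N c 1 0)))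
          (vertex N c 1 2) := by
        rw [rotate, swap_double, map_smul, map_smul, LinearMap.smul_apply]
    _ = N⁻¹ • comp (tensor (strand N 1) (vertex N c.swap 0 1))
          (comp (tensor (strand N 1) (vertex N c 1 0)) (vertex N c 1 2)) := by
        rw [← strand_tensor_comp, comp_assoc]
    _ = N⁻¹ • tensor (strand N 1) (vertex N c.swap 0 1) := by
        have h := fuse_dagger (N := N) c 1 1 0 0 0
        rw [tensor_strand_zero] at h
        have h' : comp (tensor (strand N 1) (vertex N c 1 0)) (vertex N c 1 2) = strand N 1 :=
          (congrArg (comp _) (strings_comp _).symm).trans (h.trans (vertex_one_one c))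
        exact congrArg (N⁻¹ • ·) ((congrArg (comp _) h').trans (comp_strings _))

/-- The cubic Temperley–Lieb relation. The part between the outermost legs is a bigon, with the vertex
of the other colour split off on its right. -/
theorem temperleyLieb (c : SpiderColor) :
    comp (comp (tensor (vertex N c 2 2) (strand N 1))
        (tensor (strand N 1) (vertex N c.swap 2 2))) (tensor (vertex N c 2 2) (strand N 1)) =
      N⁻¹ • tensor (vertex N c 2 2) (strand N 1) := by
  have split : vertex N c 2 2 = comp (vertex N c 1 2) (vertex N c 2 1) :=
    (vertex_comp_vertex c 2 0 2).symm
  have split' : vertex N c.swap 2 2 = comp (tensor (strand N 1) (vertex N c.swap 2 1))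
      (tensor (vertex N c.swap 1 2) (strand N 1)) :=
    ((congrArg (comp _) (strings_comp _).symm).trans (fuse_dagger c.swap 1 1 1 1 0)).symm
  have middle : comp (tensor (vertex N c 2 1) (strand N 1))
      (comp (tensor (strand N 1) (vertex N c.swap 2 2)) (tensor (vertex N c 1 2) (strand N 1))) =
      N⁻¹ • strand N 2 := by
    have far : comp (tensor (vertex N c 2 1) (strand N 1))
        (tensor (strand N 1) (tensor (strand N 1) (vertex N c.swap 2 1))) =
        comp (tensor (strand N 1) (vertex N c.swap 2 1))
          (tensor (tensor (vertex N c 2 1) (strand N 1)) (strand N 1)) := by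
      rw [← tensor_assoc_two_one, strand_tensor_strand, tensor_assoc_strand, strand_tensor_strand]
      exact (comp_tensor_strand_strand_tensor (vertex N c 2 1) (vertex N c.swap 2 1)).trans
        (comp_strand_tensor_tensor_strand (vertex N c 2 1) (vertex N c.swap 2 1)).symm
    have slide : tensor (strand N 1) (tensor (vertex N c.swap 1 2) (strand N 1)) =
        tensor (tensor (strand N 1) (vertex N c.swap 1 2)) (strand N 1) :=
      (tensor_assoc_strand _ _).symm
    have absorb : comp (vertex N c.swap 2 1) (tensor (vertex N c.swap 0 1) (strand N 1)) =
        strand N 1 :=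
      ((congrArg (comp _) (strings_comp _).symm).trans (by
        have := fuse_dagger (N := N) c.swap 0 0 1 1 0
        rw [strand_zero_tensor] at this
        exact (congrArg (fun x => comp x _) ((strings_comp _).symm.trans (congrArg (comp _)
          (comp_strings _).symm).symm.symm)).trans this)).trans (vertex_one_one c.swap)
    calc _ = comp (comp (tensor (vertex N c 2 1) (strand N 1))
          (tensor (strand N 1) (tensor (strand N 1) (vertex N c.swap 2 1))))
          (comp (tensor (strand N 1) (tensor (vertex N c.swap 1 2) (strand N 1)))
            (tensor (vertex N c 1 2) (strand N 1))) := by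
          rw [split', ← strand_tensor_comp, comp_assoc, comp_assoc]
      _ = comp (tensor (strand N 1) (vertex N c.swap 2 1))
          (tensor (comp (comp (tensor (vertex N c 2 1) (strand N 1))
            (tensor (strand N 1) (vertex N c.swap 1 2))) (vertex N c 1 2)) (strand N 1)) := by
          rw [far, slide, comp_assoc, ← tensor_strand_comp, ← tensor_strand_comp, comp_assoc]
      _ = N⁻¹ • comp (tensor (strand N 1) (vertex N c.swap 2 1))
          (tensor (strand N 1) (tensor (vertex N c.swap 0 1) (strand N 1))) := by
          rw [cut_bigon, map_smul, LinearMap.smul_apply, map_smul]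
          exact congrArg (fun x => N⁻¹ • comp (tensor (strand N 1) (vertex N c.swap 2 1)) x)
            (tensor_assoc_strand (strand N 1) (vertex N c.swap 0 1))
      _ = N⁻¹ • strand N 2 := by
          rw [strand_tensor_comp]
          exact congrArg (N⁻¹ • ·) ((congrArg _ absorb).trans (strand_tensor_strand 1 1))
  calc _ = comp (tensor (vertex N c 1 2) (strand N 1))
        (comp (comp (tensor (vertex N c 2 1) (strand N 1))
        (comp (tensor (strand N 1) (vertex N c.swap 2 2)) (tensor (vertex N c 1 2) (strand N 1))))
        (tensor (vertex N c 2 1) (strand N 1))) := by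
        rw [split, ← tensor_strand_comp]
        simp only [comp_assoc]
    _ = _ := by
        rw [middle, map_smul, LinearMap.smul_apply, map_smul, split, ← tensor_strand_comp]
        exact congrArg (N⁻¹ • ·) (congrArg (comp _) (strings_comp _))

/-! ### The two Temperley–Lieb families of four-legged vertices -/

/-- The `(2, 2)`-vertex of colour `c` on `n` strings, with `j` strings to its right. It has this
meaning for `j + 1 < n` only; otherwise the value is the identity of `n`. -/
noncomputable def node (N : ℂ) (c : SpiderColor) : (n j : ℕ) → Hom N n n
  | n + 2, 0 => tensor (strand N n) (vertex N c 2 2)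
  | n + 1, j + 1 => tensor (node N c n j) (strand N 1)
  | 0, _ => strand N 0
  | 1, 0 => strand N 1

theorem node_zero (c : SpiderColor) (n : ℕ) :
    node N c (n + 2) 0 = tensor (strand N n) (vertex N c 2 2) := by rw [node]

theorem node_succ (c : SpiderColor) (n j : ℕ) :
    node N c (n + 1) (j + 1) = tensor (node N c n j) (strand N 1) := by rw [node]

theorem node_add_two (c : SpiderColor) (n j : ℕ) :
    node N c (n + 2) (j + 2) = tensor (node N c n j) (strand N 2) := by
  rw [node_succ, node_succ, tensor_assoc_strand, strand_tensor_strand]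

theorem node_one (c : SpiderColor) (n : ℕ) :
    node N c (n + 3) 1 = tensor (strand N n) (tensor (vertex N c 2 2) (strand N 1)) := by
  rw [node_succ, node_zero, tensor_assoc_strand]

theorem node_zero' (c : SpiderColor) (n : ℕ) :
    node N c (n + 3) 0 = tensor (strand N n) (tensor (strand N 1) (vertex N c 2 2)) := by
  rw [← tensor_assoc_two_two, strand_tensor_strand, node_zero]

theorem node_idem (c : SpiderColor) (n j : ℕ) (h : j + 1 < n) :
    comp (node N c n j) (node N c n j) = node N c n j := by
  induction j generalizing n with
  | zero =>
    obtain ⟨n, rfl⟩ := Nat.exists_eq_add_of_le' h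
    rw [node_zero, strand_tensor_comp, vertex_comp_vertex c 2 1 2]
  | succ j ih =>
    obtain ⟨n, rfl⟩ := Nat.exists_eq_add_of_le' (show 1 ≤ n by omega)
    rw [node_succ, tensor_strand_comp, ih n (by omega)]

theorem node_comp_node_swap (n j : ℕ) (h : j + 1 < n) (c : SpiderColor) :
    comp (node N c n j) (node N c.swap n j) = comp (node N c.swap n j) (node N c n j) := by
  induction j generalizing n with
  | zero =>
    obtain ⟨n, rfl⟩ := Nat.exists_eq_add_of_le' h
    rw [node_zero, node_zero, strand_tensor_comp, strand_tensor_comp, vertex_comp_vertex_swap]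
    have := vertex_comp_vertex_swap (N := N) c.swap
    rw [show c.swap.swap = c by cases c <;> rfl] at this
    rw [this]
  | succ j ih =>
    obtain ⟨n, rfl⟩ := Nat.exists_eq_add_of_le' (show 1 ≤ n by omega)
    rw [node_succ, node_succ, tensor_strand_comp, tensor_strand_comp, ih n (by omega)]

theorem node_comm_neighbours (c : SpiderColor) (n j : ℕ) (h : j + 2 < n) :
    comp (node N c n (j + 1)) (node N c n j) = comp (node N c n j) (node N c n (j + 1)) := by
  induction j generalizing n with
  | zero =>
    obtain ⟨n, rfl⟩ := Nat.exists_eq_add_of_le' h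
    rw [node_zero', node_one, strand_tensor_comp, strand_tensor_comp, ← commute_neighbours]
  | succ j ih =>
    obtain ⟨n, rfl⟩ := Nat.exists_eq_add_of_le' (show 1 ≤ n by omega)
    rw [node_succ, node_succ c n j, tensor_strand_comp, tensor_strand_comp, ih n (by omega)]

theorem node_temperleyLieb (c : SpiderColor) (n j : ℕ) (h : j + 2 < n) :
    comp (comp (node N c n (j + 1)) (node N c.swap n j)) (node N c n (j + 1)) =
      N⁻¹ • node N c n (j + 1) := by
  induction j generalizing n with
  | zero =>
    obtain ⟨n, rfl⟩ := Nat.exists_eq_add_of_le' h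
    rw [node_zero', node_one, strand_tensor_comp, strand_tensor_comp, temperleyLieb, map_smul]
  | succ j ih =>
    obtain ⟨n, rfl⟩ := Nat.exists_eq_add_of_le' (show 1 ≤ n by omega)
    rw [node_succ, node_succ c.swap n j, tensor_strand_comp, tensor_strand_comp, ih n (by omega),
      map_smul, LinearMap.smul_apply]

theorem node_comm_far (c c' : SpiderColor) (n i j : ℕ) (hij : i + 2 ≤ j) (h : j + 1 < n) :
    comp (node N c n j) (node N c' n i) = comp (node N c' n i) (node N c n j) := by
  induction i generalizing n j with
  | zero =>
    obtain ⟨n, rfl⟩ := Nat.exists_eq_add_of_le' (show 2 ≤ n by omega)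
    obtain ⟨j, rfl⟩ := Nat.exists_eq_add_of_le' (show 2 ≤ j by omega)
    rw [node_zero, node_add_two, comp_tensor_strand_strand_tensor,
      comp_strand_tensor_tensor_strand]
  | succ i ih =>
    obtain ⟨n, rfl⟩ := Nat.exists_eq_add_of_le' (show 1 ≤ n by omega)
    obtain ⟨j, rfl⟩ := Nat.exists_eq_add_of_le' (show 1 ≤ j by omega)
    rw [node_succ, node_succ, tensor_strand_comp, tensor_strand_comp,
      ih n j (by omega) (by omega)]

/-- The colour `c` at even positions and the other colour at odd positions. -/
def alternate (c : SpiderColor) (j : ℕ) : SpiderColor := if Even j then c else c.swap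

theorem swap_swap (c : SpiderColor) : c.swap.swap = c := by cases c <;> rfl

theorem alternate_succ (c : SpiderColor) (j : ℕ) : alternate c (j + 1) = (alternate c j).swap := by
  by_cases h : Even j <;> simp [alternate, Nat.even_add_one, h, swap_swap]

theorem alternate_swap (c : SpiderColor) (j : ℕ) : alternate c.swap j = (alternate c j).swap := by
  unfold alternate; split_ifs <;> rfl

/-- The family of `(2, 2)`-vertices on `n` strings whose colours alternate, starting with `c` at the
right. -/
noncomputable def altNode (N : ℂ) (c : SpiderColor) (n j : ℕ) : End (⟨n⟩ : NCBipart N) :=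
  node N (alternate c j) n j

theorem isGenerators_altNode (c : SpiderColor) (n : ℕ) :
    TemperleyLieb.IsGenerators (altNode N c n) n N⁻¹ where
  idem j hj := node_idem _ n j hj
  cubic j hj := by
    have := node_temperleyLieb (N := N) (alternate c (j + 1)) n j hj
    rw [show (alternate c (j + 1)).swap = alternate c j by rw [alternate_succ, swap_swap]] at this
    exact this
  far i j hij hj := node_comm_far _ _ n i j hij hj

theorem commute_altNode_succ (c : SpiderColor) {n i : ℕ} (hi : i + 2 < n) :
    Commute (altNode N c n i) (altNode N c.swap n (i + 1)) := by
  have e : alternate c.swap (i + 1) = alternate c i := by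
    rw [alternate_succ, alternate_swap, swap_swap]
  unfold altNode
  rw [e]
  exact (node_comm_neighbours _ n i hi).symm

/-- The two alternating families commute: at equal positions the colours differ and both products
are `N⁻¹ • cup ∘ cap`, at neighbouring positions the colours agree. -/
theorem commute_altNode (c : SpiderColor) {n i j : ℕ} (hi : i + 1 < n) (hj : j + 1 < n) :
    Commute (altNode N c n i) (altNode N c.swap n j) := by
  rcases lt_trichotomy i j with h | rfl | h
  · rcases (show i + 1 = j ∨ i + 2 ≤ j by omega) with rfl | h
    · exact commute_altNode_succ c hj
    · exact (node_comm_far _ _ n i j h hj).symm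
  · have := node_comp_node_swap (N := N) n i hi (alternate c i)
    rw [← alternate_swap] at this
    exact this
  · rcases (show j + 1 = i ∨ j + 2 ≤ i by omega) with rfl | h
    · have := commute_altNode_succ (N := N) c.swap hi
      rw [swap_swap] at this
      exact this.symm
    · exact node_comm_far _ _ n j i h hi

/-! ### Padding with cups and caps -/

/-- `k` strings with `q` cups to their right. -/
noncomputable def cups (N : ℂ) (k : ℕ) : (q : ℕ) → Hom N k (k + 2 * q)
  | 0 => strand N k
  | q + 1 => tensor (cups N k q) (vertex N .black 0 2)

/-- `k` strings with `q` caps to their right. -/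
noncomputable def caps (N : ℂ) (k : ℕ) : (q : ℕ) → Hom N (k + 2 * q) k
  | 0 => strand N k
  | q + 1 => tensor (caps N k q) (vertex N .black 2 0)

theorem cups_succ (k q : ℕ) : cups N k (q + 1) = tensor (cups N k q) (vertex N .black 0 2) := by
  rw [cups]

theorem caps_succ (k q : ℕ) : caps N k (q + 1) = tensor (caps N k q) (vertex N .black 2 0) := by
  rw [caps]

theorem caps_comp_cups (k q : ℕ) : comp (caps N k q) (cups N k q) = N ^ q • strand N k := by
  induction q with
  | zero =>
    rw [pow_zero, one_smul]
    exact strings_comp _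
  | succ q ih =>
    rw [cups_succ, caps_succ]
    refine (interchange (caps N k q) (vertex N .black 2 0) (cups N k q)
      (vertex N .black 0 2)).trans ?_
    rw [ih, cap_comp_cup, map_smul, tensor_strand_zero, smul_smul, pow_succ']

theorem node_comp_cups (c : SpiderColor) (k q i : ℕ) (hi : i < q) :
    comp (node N c (k + 2 * q) (2 * i)) (cups N k q) = cups N k q := by
  induction q generalizing i with
  | zero => omega
  | succ q ih =>
    rw [cups_succ]
    rcases i with _ | i
    · refine (congrArg (fun x => comp x _) (node_zero c (k + 2 * q))).trans ?_
      refine (interchange (strand N (k + 2 * q)) (vertex N c 2 2) (cups N k q)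
        (vertex N .black 0 2)).trans ?_
      rw [strings_comp, vertex_zero_two .black c, vertex_comp_vertex c 0 1 2]
    · refine (congrArg (fun x => comp x _) (node_add_two c (k + 2 * q) (2 * i))).trans ?_
      refine (interchange (node N c (k + 2 * q) (2 * i)) (strand N 2) (cups N k q)
        (vertex N .black 0 2)).trans ?_
      rw [strings_comp, ih i (by omega)]

theorem caps_comp_node (c : SpiderColor) (k q i : ℕ) (hi : i < q) :
    comp (caps N k q) (node N c (k + 2 * q) (2 * i)) = caps N k q := by
  induction q generalizing i with
  | zero => omega
  | succ q ih =>
    rw [caps_succ]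
    rcases i with _ | i
    · refine (congrArg (comp _) (node_zero c (k + 2 * q))).trans ?_
      refine (interchange (caps N k q) (vertex N .black 2 0) (strand N (k + 2 * q))
        (vertex N c 2 2)).trans ?_
      rw [comp_strings, vertex_two_zero .black c, vertex_comp_vertex c 2 1 0]
    · refine (congrArg (comp _) (node_add_two c (k + 2 * q) (2 * i))).trans ?_
      refine (interchange (caps N k q) (vertex N .black 2 0) (node N c (k + 2 * q) (2 * i))
        (strand N 2)).trans ?_
      rw [comp_strings, ih i (by omega)]

/-- Scalar multiples of words in the `(2, 2)`-vertices with any number of strings on both sides.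
Source and target are equal, but they need not be so by definition, hence the constructor
`eqStrand`. -/
inductive IsWord : {k l : ℕ} → Hom N k l → Prop
  | eqStrand {k l : ℕ} (h : k = l) : IsWord (eqStrand N h)
  | vertex (c : SpiderColor) (n : ℕ) : IsWord (tensor (strand N n) (vertex N c 2 2))
  | whisker {k l : ℕ} {x : Hom N k l} : IsWord x → IsWord (tensor x (strand N 1))
  | comp {k l m : ℕ} {y : Hom N l m} {x : Hom N k l} : IsWord y → IsWord x → IsWord (comp y x)
  | smul {k l : ℕ} (z : ℂ) {x : Hom N k l} : IsWord x → IsWord (z • x)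

/-- The algebra generated by all `(2, 2)`-vertices on `n` strings, sorted into the two alternating
families. -/
noncomputable def nodeAlgebra (N : ℂ) (n : ℕ) : Subalgebra ℂ (End (⟨n⟩ : NCBipart N)) :=
  Algebra.adjoin ℂ {x | ∃ j, j + 1 < n ∧ (x = altNode N .black n j ∨ x = altNode N .white n j)}

theorem node_mem_nodeAlgebra (c : SpiderColor) {n j : ℕ} (hj : j + 1 < n) :
    (node N c n j : End (⟨n⟩ : NCBipart N)) ∈ nodeAlgebra N n := by
  refine Algebra.subset_adjoin ⟨j, hj, ?_⟩
  unfold altNode alternate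
  cases c <;> by_cases h : Even j <;> simp [h, SpiderColor.swap]

theorem comp_mem_nodeAlgebra {y x : End (⟨n⟩ : NCBipart N)} (hy : y ∈ nodeAlgebra N n)
    (hx : x ∈ nodeAlgebra N n) : (comp y x : Hom N n n) ∈ nodeAlgebra N n :=
  mul_mem hy hx

theorem smul_mem_nodeAlgebra (z : ℂ) {x : End (⟨n⟩ : NCBipart N)} (hx : x ∈ nodeAlgebra N n) :
    (z • (x : Hom N n n) : Hom N n n) ∈ nodeAlgebra N n :=
  Subalgebra.smul_mem _ hx z

/-- Adding a string on the right, as a homomorphism of endomorphism algebras. -/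
noncomputable def whiskerHom (N : ℂ) (n : ℕ) :
    End (⟨n⟩ : NCBipart N) →ₐ[ℂ] End (⟨n + 1⟩ : NCBipart N) :=
  AlgHom.ofLinearMap ((tensor (N := N) (k := n) (l := n)).flip (strand N 1))
    (strand_tensor_strand n 1) fun x y => (tensor_strand_comp 1 x y).symm

theorem tensor_strand_mem_nodeAlgebra {x : Hom N n n} (hx : x ∈ nodeAlgebra N n) :
    tensor x (strand N 1) ∈ nodeAlgebra N (n + 1) := by
  have h : nodeAlgebra N n ≤ (nodeAlgebra N (n + 1)).comap (whiskerHom N n) := by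
    refine Algebra.adjoin_le ?_
    have mem (c : SpiderColor) (j : ℕ) (hj : j + 1 < n) :
        altNode N c n j ∈ (nodeAlgebra N (n + 1)).comap (whiskerHom N n) := by
      have := node_mem_nodeAlgebra (N := N) (alternate c j) (Nat.succ_lt_succ hj)
      rw [node_succ] at this
      exact this
    rintro _ ⟨j, hj, rfl | rfl⟩ <;> exact mem _ j hj
  exact h hx

theorem IsWord.exists_mem {x : Hom N k l} (hx : IsWord x) :
    ∃ h : k = l, NCBipart.comp (NCBipart.eqStrand N h.symm) x ∈ nodeAlgebra N k := by
  induction hx with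
  | eqStrand h =>
    subst h
    refine ⟨rfl, ?_⟩
    rw [stringsEq_comp]
    exact one_mem _
  | vertex c n =>
    refine ⟨rfl, ?_⟩
    rw [← node_zero]
    have := node_mem_nodeAlgebra (N := N) c (n := n + 2) (j := 0) (by omega)
    exact (congrArg (· ∈ nodeAlgebra N (n + 2)) (strings_comp _)).mpr this
  | whisker _ ih =>
    obtain ⟨rfl, ih⟩ := ih
    refine ⟨rfl, ?_⟩
    have := tensor_strand_mem_nodeAlgebra ((congrArg (· ∈ nodeAlgebra N _) (strings_comp _)).mp ih)
    exact (congrArg (· ∈ nodeAlgebra N _) (strings_comp _)).mpr this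
  | comp _ _ ihy ihx =>
    obtain ⟨rfl, ihx⟩ := ihx
    obtain ⟨rfl, ihy⟩ := ihy
    refine ⟨rfl, ?_⟩
    rw [← comp_assoc]
    exact comp_mem_nodeAlgebra ihy ((congrArg (· ∈ nodeAlgebra N _) (strings_comp _)).mp ihx)
  | smul z _ ih =>
    obtain ⟨rfl, ih⟩ := ih
    refine ⟨rfl, ?_⟩
    rw [map_smul]
    exact smul_mem_nodeAlgebra z ih

theorem IsWord.turn (n : ℕ) (hN : N ≠ 0) : IsWord (tensor (strand N n) (NCBipart.turn N)) := by
  have h : NCBipart.turn N = N • NCBipart.comp (NCBipart.vertex N .black 2 2)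
      (NCBipart.vertex N .white 2 2) := by
    have := vertex_comp_vertex_swap (N := N) .black
    rw [show SpiderColor.black.swap = .white from rfl] at this
    rw [this, smul_smul, mul_inv_cancel₀ hN, one_smul]
  rw [h, map_smul, ← strand_tensor_comp]
  exact .smul _ (.comp (.vertex _ _) (.vertex _ _))

theorem IsWord.strand (n : ℕ) : IsWord (NCBipart.strand N n) := .eqStrand rfl

theorem IsWord.tensor_strand_two {x : Hom N k l} (hx : IsWord x) :
    IsWord (tensor x (NCBipart.strand N 2)) := by
  have := hx.whisker.whisker
  rwa [tensor_assoc_strand, strand_tensor_strand] at this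

/-- A string can be moved from the right of the cups to their left by a word: by the zigzag identity,
`cup ∘ cap` carries it past one cup. -/
theorem exists_cups_succ (hN : N ≠ 0) (k q : ℕ) :
    ∃ u : Hom N (k + 2 * q + 1) (k + 1 + 2 * q), IsWord u ∧
      cups N (k + 1) q = comp u (tensor (cups N k q) (strand N 1)) := by
  induction q with
  | zero =>
    refine ⟨strand N (k + 1), .strand _, ?_⟩
    exact (strings_comp _).symm.trans (congrArg (comp _) (strand_tensor_strand k 1).symm)
  | succ q ih =>
    obtain ⟨u, hu, e⟩ := ih
    have slide : tensor (strand N 1) (vertex N .black 0 2) =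
        comp (tensor (strand N 1) (turn N)) (tensor (vertex N .black 0 2) (strand N 1)) := by
      rw [turn, ← strand_tensor_comp, comp_assoc, zigzag]
      exact (comp_strings _).symm
    refine ⟨comp (tensor u (strand N 2))
      (tensor (strand N (k + 2 * q)) (tensor (strand N 1) (turn N))),
      .comp hu.tensor_strand_two ?_, ?_⟩
    · rw [← tensor_assoc_two_two, strand_tensor_strand]
      exact .turn _ hN
    · calc cups N (k + 1) (q + 1)
          = tensor (comp u (tensor (cups N k q) (strand N 1)))
              (comp (strand N 2) (vertex N .black 0 2)) := by rw [cups_succ, e, strings_comp]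
        _ = comp (tensor u (strand N 2))
              (tensor (tensor (cups N k q) (strand N 1)) (vertex N .black 0 2)) :=
            (interchange u (strand N 2) (tensor (cups N k q) (strand N 1))
              (vertex N .black 0 2)).symm
        _ = comp (tensor u (strand N 2)) (tensor (comp (strand N (k + 2 * q)) (cups N k q))
              (comp (tensor (strand N 1) (turn N))
                (tensor (vertex N .black 0 2) (strand N 1)))) := by
            rw [← slide, strings_comp]
            exact congrArg (comp _) (tensor_assoc_zero_two (cups N k q) (strand N 1) _)
        _ = comp (tensor u (strand N 2))
              (comp (tensor (strand N (k + 2 * q)) (tensor (strand N 1) (turn N)))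
                (tensor (cups N k q) (tensor (vertex N .black 0 2) (strand N 1)))) :=
            congrArg (comp _) (interchange (strand N (k + 2 * q)) (tensor (strand N 1) (turn N))
              (cups N k q) (tensor (vertex N .black 0 2) (strand N 1))).symm
        _ = _ := by
            rw [← tensor_assoc_strand, ← cups_succ]
            exact (comp_assoc _ _ _).symm

/-- The upside-down version of `exists_cups_succ`. -/
theorem exists_caps_succ (hN : N ≠ 0) (k q : ℕ) :
    ∃ u : Hom N (k + 1 + 2 * q) (k + 2 * q + 1), IsWord u ∧
      caps N (k + 1) q = comp (tensor (caps N k q) (strand N 1)) u := by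
  induction q with
  | zero =>
    refine ⟨strand N (k + 1), .strand _, ?_⟩
    exact (comp_strings _).symm.trans
      (congrArg (fun x => comp x _) (strand_tensor_strand k 1).symm)
  | succ q ih =>
    obtain ⟨u, hu, e⟩ := ih
    have slide : tensor (strand N 1) (vertex N .black 2 0) =
        comp (tensor (vertex N .black 2 0) (strand N 1)) (tensor (strand N 1) (turn N)) := by
      rw [turn, ← strand_tensor_comp, ← comp_assoc, zigzag']
      exact (strings_comp _).symm
    refine ⟨comp (tensor (strand N (k + 2 * q)) (tensor (strand N 1) (turn N)))
      (tensor u (strand N 2)),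
      .comp ?_ hu.tensor_strand_two, ?_⟩
    · rw [← tensor_assoc_two_two, strand_tensor_strand]
      exact .turn _ hN
    · calc caps N (k + 1) (q + 1)
          = tensor (comp (tensor (caps N k q) (strand N 1)) u)
              (comp (vertex N .black 2 0) (strand N 2)) := by rw [caps_succ, e, comp_strings]
        _ = comp (tensor (tensor (caps N k q) (strand N 1)) (vertex N .black 2 0))
              (tensor u (strand N 2)) :=
            (interchange (tensor (caps N k q) (strand N 1)) (vertex N .black 2 0) u
              (strand N 2)).symm
        _ = comp (tensor (comp (caps N k q) (strand N (k + 2 * q)))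
              (comp (tensor (vertex N .black 2 0) (strand N 1))
                (tensor (strand N 1) (turn N)))) (tensor u (strand N 2)) := by
            rw [← slide, comp_strings]
            exact congrArg (fun x => comp x _)
              (tensor_assoc_two_zero (caps N k q) (strand N 1) _)
        _ = comp (comp (tensor (caps N k q) (tensor (vertex N .black 2 0) (strand N 1)))
              (tensor (strand N (k + 2 * q)) (tensor (strand N 1) (turn N))))
              (tensor u (strand N 2)) :=
            congrArg (fun x => comp x _) (interchange (caps N k q)
              (tensor (vertex N .black 2 0) (strand N 1)) (strand N (k + 2 * q))
              (tensor (strand N 1) (turn N))).symm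
        _ = _ := by
            rw [← tensor_assoc_strand, ← caps_succ]
            exact comp_assoc _ _ _

/-- Composites of layers, each of which is a single vertex, cup or cap with strings on both sides. -/
inductive IsLayered (N : ℂ) : {k l : ℕ} → Hom N k l → Prop
  | strand (k : ℕ) : IsLayered N (strand N k)
  | vertex (c : SpiderColor) (n : ℕ) : IsLayered N (tensor (NCBipart.strand N n) (vertex N c 2 2))
  | cap (n : ℕ) : IsLayered N (tensor (NCBipart.strand N n) (NCBipart.vertex N .black 2 0))
  | cup (n : ℕ) : IsLayered N (tensor (NCBipart.strand N n) (NCBipart.vertex N .black 0 2))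
  | whisker {k l : ℕ} {x : Hom N k l} :
      IsLayered N x → IsLayered N (tensor x (NCBipart.strand N 1))
  | comp {k l m : ℕ} {y : Hom N l m} {x : Hom N k l} :
      IsLayered N y → IsLayered N x → IsLayered N (comp y x)

theorem IsLayered.tensor_strand {x : Hom N k l} (hx : IsLayered N x) (n : ℕ) :
    IsLayered N (tensor x (NCBipart.strand N n)) := by
  induction n with
  | zero => rw [tensor_strand_zero]; exact hx
  | succ n ih =>
    rw [← strand_tensor_strand n 1, ← tensor_assoc_strand]
    exact ih.whisker

theorem IsLayered.strand_tensor {x : Hom N k l} (hx : IsLayered N x) (n : ℕ) :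
    IsLayered N (tensor (NCBipart.strand N n) x) := by
  induction hx with
  | strand k => rw [strand_tensor_strand]; exact .strand _
  | vertex c m =>
    rw [← tensor_assoc_two_two, strand_tensor_strand]; exact .vertex c _
  | cap m =>
    rw [← tensor_assoc_two_zero, strand_tensor_strand]; exact .cap _
  | cup m =>
    rw [← tensor_assoc_zero_two, strand_tensor_strand]; exact .cup _
  | whisker _ ih => rw [← tensor_assoc_strand]; exact ih.whisker
  | comp _ _ ihy ihx => rw [← strand_tensor_comp]; exact ihy.comp ihx

theorem IsLayered.tensor {x : Hom N k l} {y : Hom N k' l'} (hx : IsLayered N x)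
    (hy : IsLayered N y) : IsLayered N (NCBipart.tensor x y) := by
  rw [← comp_tensor_strand_strand_tensor]
  exact (hx.tensor_strand _).comp (hy.strand_tensor _)

theorem dagger_dagger (d : SpiderDiagram k l) : d.dagger.dagger = d := by
  induction d with
  | strings => rfl
  | spider => rfl
  | comp b a hb ha => simp only [SpiderDiagram.dagger, ha, hb]
  | tensor a b ha hb => simp only [SpiderDiagram.dagger, ha, hb]

/-- Both `d` and `d.dagger` are carried along since `IsEven` is closed under `dagger`. -/
theorem isLayered_of_isEven (N : ℂ) {d : SpiderDiagram k l} (h : d.IsEven) :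
    IsLayered N (ofDiagram N d) ∧ IsLayered N (ofDiagram N d.dagger) := by
  induction h with
  | connecter c =>
    have := IsLayered.vertex (N := N) c 0
    rw [strand_zero_tensor] at this
    have e : comp (eqStrand N (Nat.zero_add 2).symm)
        (comp (vertex N c 2 2) (eqStrand N (Nat.zero_add 2))) = vertex N c 2 2 :=
      (strings_comp _).trans (comp_strings _)
    rw [e] at this
    exact ⟨this, this⟩
  | cap =>
    have e : comp (eqStrand N (Nat.zero_add 0).symm)
        (comp (vertex N .black 2 0) (eqStrand N (Nat.zero_add 2))) = vertex N .black 2 0 :=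
      (strings_comp _).trans (comp_strings _)
    have e' : comp (eqStrand N (Nat.zero_add 2).symm)
        (comp (vertex N .black 0 2) (eqStrand N (Nat.zero_add 0))) = vertex N .black 0 2 :=
      (strings_comp _).trans (comp_strings _)
    have h := IsLayered.cap (N := N) 0
    have h' := IsLayered.cup (N := N) 0
    rw [strand_zero_tensor] at h h'
    rw [e] at h
    rw [e'] at h'
    exact ⟨h, h'⟩
  | strings k => exact ⟨.strand k, .strand k⟩
  | comp _ _ hb ha =>
    simp only [SpiderDiagram.dagger, ← comp_ofDiagram]
    exact ⟨hb.1.comp ha.1, ha.2.comp hb.2⟩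
  | tensor _ _ ha hb =>
    simp only [SpiderDiagram.dagger, ← tensor_ofDiagram]
    exact ⟨ha.1.tensor hb.1, ha.2.tensor hb.2⟩
  | dagger _ h => exact ⟨h.2, by rw [dagger_dagger]; exact h.1⟩

/-- One more cup and cap on the padding only adds `cup ∘ cap` on the right. -/
theorem IsWord.pad_succ (hN : N ≠ 0) {x : Hom N k l} {p q : ℕ}
    (h : IsWord (NCBipart.comp (cups N l q) (NCBipart.comp x (caps N k p)))) :
    IsWord (NCBipart.comp (cups N l (q + 1)) (NCBipart.comp x (caps N k (p + 1)))) := by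
  have e : NCBipart.comp (cups N l (q + 1)) (NCBipart.comp x (caps N k (p + 1))) =
      tensor (NCBipart.comp (cups N l q) (NCBipart.comp x (caps N k p))) (NCBipart.turn N) := by
    have e₁ : NCBipart.comp x (caps N k (p + 1)) =
        tensor (NCBipart.comp x (caps N k p)) (NCBipart.vertex N .black 2 0) := by
      rw [caps_succ]
      refine (congrArg (fun y => NCBipart.comp y _) (tensor_strand_zero x).symm).trans ?_
      refine (interchange x (NCBipart.strand N 0) (caps N k p)
        (NCBipart.vertex N .black 2 0)).trans ?_
      rw [strings_comp]
    rw [e₁, cups_succ, NCBipart.turn]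
    exact interchange (cups N l q) (NCBipart.vertex N .black 0 2) (NCBipart.comp x (caps N k p))
      (NCBipart.vertex N .black 2 0)
  rw [e, ← comp_strand_tensor_tensor_strand]
  exact (IsWord.turn _ hN).comp h.tensor_strand_two

theorem IsWord.pad_add (hN : N ≠ 0) {x : Hom N k l} {p q : ℕ}
    (h : IsWord (NCBipart.comp (cups N l q) (NCBipart.comp x (caps N k p)))) (r : ℕ) :
    IsWord (NCBipart.comp (cups N l (q + r)) (NCBipart.comp x (caps N k (p + r)))) := by
  induction r with
  | zero => exact h
  | succ r ih => exact ih.pad_succ hN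

/-- Padded with suitable numbers of cups and caps, a composite of layers becomes a multiple of a word.
For a composition, the paddings are first enlarged until the caps of the one factor match the cups of
the other; what is left between the factors is a power of the loop value `N`. -/
theorem IsLayered.exists_isWord (hN : N ≠ 0) {x : Hom N k l} (hx : IsLayered N x) :
    ∃ p q, IsWord (NCBipart.comp (cups N l q) (NCBipart.comp x (caps N k p))) := by
  induction hx with
  | strand k => exact ⟨0, 0, .comp (.strand _) (.comp (.strand _) (.strand _))⟩
  | vertex c n => exact ⟨0, 0, .comp (.strand _) (.comp (.vertex c n) (.strand _))⟩
  | cap n =>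
    refine ⟨0, 1, ?_⟩
    have h := IsWord.turn (N := N) n hN
    rw [turn, ← strand_tensor_comp] at h
    exact (congrArg (fun y => IsWord (NCBipart.comp (cups N n 1) y)) (comp_strings _)).mpr h
  | cup n =>
    refine ⟨1, 0, ?_⟩
    have h := IsWord.turn (N := N) n hN
    rw [turn, ← strand_tensor_comp] at h
    exact (congrArg IsWord (strings_comp _)).mpr h
  | @whisker k l x _ ih =>
    obtain ⟨p, q, h⟩ := ih
    obtain ⟨u, hu, eu⟩ := exists_cups_succ hN l q
    obtain ⟨v, hv, ev⟩ := exists_caps_succ hN k p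
    refine ⟨p, q, ?_⟩
    have e : NCBipart.comp (cups N (l + 1) q)
        (NCBipart.comp (NCBipart.tensor x (NCBipart.strand N 1))
        (caps N (k + 1) p)) = NCBipart.comp u (NCBipart.comp (NCBipart.tensor
          (NCBipart.comp (cups N l q) (NCBipart.comp x (caps N k p))) (NCBipart.strand N 1)) v) := by
      rw [eu, ev, ← tensor_strand_comp, ← tensor_strand_comp]
      simp only [comp_assoc]
    rw [e]
    exact hu.comp (h.whisker.comp hv)
  | @comp k l m y x _ _ ihy ihx =>
    obtain ⟨p, q, h⟩ := ihx
    obtain ⟨p', q', h'⟩ := ihy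
    refine ⟨p + p', q' + q, ?_⟩
    have h₁ := h.pad_add hN p'
    have h₂ := h'.pad_add hN q
    rw [add_comm p' q] at h₂
    have h₃ := (h₂.comp h₁).smul (N ^ (q + p'))⁻¹
    have e : NCBipart.comp (NCBipart.comp (cups N m (q' + q)) (NCBipart.comp y (caps N l (q + p'))))
        (NCBipart.comp (cups N l (q + p')) (NCBipart.comp x (caps N k (p + p')))) =
        N ^ (q + p') • NCBipart.comp (cups N m (q' + q))
          (NCBipart.comp (NCBipart.comp y x) (caps N k (p + p'))) := by
      rw [comp_assoc, comp_assoc, ← comp_assoc (caps N l _), caps_comp_cups, map_smul,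
        LinearMap.smul_apply, strings_comp, map_smul, map_smul, ← comp_assoc y]
    rwa [e, smul_smul, inv_mul_cancel₀ (pow_ne_zero _ hN), one_smul] at h₃

/-- A closed even diagram is a scalar multiple of the identity: `d` is recovered from
`F ∘ (cups ∘ d ∘ caps) ∘ F`, where `F = cups ∘ caps`. -/
theorem exists_smul_of_isEven (hN : N ≠ 0) {d : SpiderDiagram 0 0} (hd : d.IsEven) :
    ∃ z : ℂ, ofDiagram N d = z • strand N 0 := by
  obtain ⟨p, q, h⟩ := (isLayered_of_isEven N hd).1.exists_isWord hN
  obtain ⟨hpq, h⟩ := h.exists_mem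
  obtain rfl : p = q := by omega
  replace h := (congrArg (· ∈ nodeAlgebra N _) (strings_comp _)).mp h
  have hF : ∀ x : Hom N (0 + 2 * p) (0 + 2 * p), x ∈ nodeAlgebra N (0 + 2 * p) → ∃ w : ℂ,
      comp (comp (comp (cups N 0 p) (caps N 0 p)) x) (comp (cups N 0 p) (caps N 0 p)) =
        w • comp (comp (cups N 0 p) (caps N 0 p)) (comp (cups N 0 p) (caps N 0 p)) := by
    intro x hx
    have absorb (c : SpiderColor) (i : ℕ) (hi : 2 * i + 1 < 0 + 2 * p) :
        comp (node N c (0 + 2 * p) (2 * i)) (comp (cups N 0 p) (caps N 0 p)) =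
          comp (cups N 0 p) (caps N 0 p) := by
      rw [← comp_assoc, node_comp_cups c 0 p i (by omega)]
    have absorb' (c : SpiderColor) (i : ℕ) (hi : 2 * i + 1 < 0 + 2 * p) :
        comp (comp (cups N 0 p) (caps N 0 p)) (node N c (0 + 2 * p) (2 * i)) =
          comp (cups N 0 p) (caps N 0 p) := by
      rw [comp_assoc, caps_comp_node c 0 p i (by omega)]
    exact TemperleyLieb.exists_smul_of_absorbs_pair (r := p)
      (F := (comp (cups N 0 p) (caps N 0 p) : Hom N (0 + 2 * p) (0 + 2 * p)))
      (isGenerators_altNode .black _) (isGenerators_altNode .white _)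
      (fun i j hi hj => commute_altNode .black hi hj) (Nat.zero_add _)
      (fun i hi => absorb _ i hi) (fun i hi => absorb' _ i hi)
      (fun i hi => absorb _ i hi) (fun i hi => absorb' _ i hi) hx
  obtain ⟨w, hw⟩ := hF _ h
  have bubble (y : Hom N 0 0) : comp (caps N 0 p) (comp (cups N 0 p) y) = N ^ p • y := by
    rw [← comp_assoc, caps_comp_cups, map_smul, LinearMap.smul_apply, strings_comp]
  have key := congrArg (fun y => comp (caps N 0 p) (comp y (cups N 0 p))) hw
  simp only [comp_assoc, bubble, caps_comp_cups, map_smul, LinearMap.smul_apply, comp_strings,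
    smul_smul] at key
  have hc : N ^ p ≠ 0 := pow_ne_zero _ hN
  rw [← inv_smul_smul₀ (mul_ne_zero (mul_ne_zero (mul_ne_zero hc hc) hc) hc) (ofDiagram N d), key,
    smul_smul]
  exact ⟨_, rfl⟩

end NCBipart

/-! ### The endomorphisms of the unit -/

namespace NCBipart

variable {N : ℂ}

theorem exists_smul_of_mem_evenHom (hN : N ≠ 0) {x : Hom N 0 0} (hx : x ∈ evenHom N 0 0) :
    ∃ z : ℂ, x = z • strand N 0 := by
  have h : evenHom N 0 0 ≤ Submodule.span ℂ {strand N 0} := by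
    refine Submodule.span_le.2 ?_
    rintro _ ⟨d, hd, rfl⟩
    obtain ⟨z, hz⟩ := exists_smul_of_isEven hN hd
    exact Submodule.mem_span_singleton.2 ⟨z, hz.symm⟩
  obtain ⟨z, hz⟩ := Submodule.mem_span_singleton.1 (h hx)
  exact ⟨z, hz.symm⟩

theorem smul_strand_zero_injective (hN : N ≠ 0) :
    Function.Injective fun z : ℂ => z • strand N 0 :=
  smul_left_injective ℂ (ofDiagram_strings_zero_ne_zero hN)

end NCBipart

theorem mainTheorem5 (N : ℂ) (hN : N ≠ 0) :
    IsPureCategory (NCBipartEven N) ∧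
      ∀ d : SpiderDiagram 0 0, d.IsEven →
        ∃! z : ℂ, NCBipart.ofDiagram N d = z • NCBipart.ofDiagram N (.strings 0) := by
  refine ⟨⟨fun z w h => ?_, fun x => ?_⟩, fun d hd => ?_⟩
  · exact NCBipart.smul_strand_zero_injective hN (congrArg Subtype.val h)
  · obtain ⟨z, hz⟩ := NCBipart.exists_smul_of_mem_evenHom hN x.2
    exact ⟨z, Subtype.ext hz.symm⟩
  · obtain ⟨z, hz⟩ := NCBipart.exists_smul_of_isEven hN hd
    exact ⟨z, hz, fun w hw => NCBipart.smul_strand_zero_injective hN (hw.symm.trans hz)⟩
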